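/- Let $F_q$ be a finite field of odd characteristic with $q$ elements, and let $A=F_q[y]$, $y^2=0$, with the involution $(r+sy)^*=r-sy$ ($r,s\in F_q$). Let $V$ be a free $A$-module of finite rank $m\ge 1$ and let $h:V\times V\to A$ be a non-degenerate $*$-hermitian form ($A$-linear in the second variable, $h(v,u)=h(u,v)^*$, and $v\mapsto h(v,-)$ is a bijection from $V$ onto its dual). Let $U=\{g\in \mathrm{GL}_A(V) : h(gu,gv)=h(u,v)\text{ for all }u,v\in V\}$ be its unitary group, let $\iota\in U$ be $v\mapsto -v$, and let $N=\{z\in A^\times : zz^*=1\}$, acting on $V$ by scalar multiplication, so that $N\subseteq U$. Let $\lambda:F_q^+\to\mathbb C^\times$ be a non-trivial character and put $\mu(r+sy)=\lambda(2s)$. Let $H=A\times V$ be the Heisenberg group, with $(a,v)(b,w)=(a+b+h(v,w),\,v+w)$, on which $U$ acts by ${}^g(a,v)=(a,gv)$. The Weil module $X$ is the restriction to $U$ of the $\mathbb C(H\rtimes U)$-module induced from the linear character $(a,u)g\mapsto\mu(a)$ of the subgroup $(A,yV)\rtimes U$ (acting on $\mathbb C\zeta$). For $v\in V$ put $e_v=(0,v)\otimes\zeta\in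 X$, so that $ge_v=e_{gv}$ for $g\in U$. Call $v\in V$ primitive if $v\notin yV$. Let $Top$ (resp. $Bot$) be the submodule of $X$ spanned by all $e_v$ with $v$ primitive (resp. not primitive), and let $Top^{\pm}$ be the eigenspace of $\iota$ acting on $Top$ for the eigenvalue $\pm1$. For $v\in V$ let $C(v)=\{g\in U : gv\equiv v \bmod yV\}$, let $\beta_v:C(v)\to\mathbb C^\times$ be the linear character $\beta_v(g)=\mu(h(gv,v))$, and let $B(v)=C(v)N$. For primitive $v,w$ write $v\sim w$ if $gv\equiv w\bmod yV$ for some $g\in U$, and let $S$ be a set of representatives of the primitive vectors modulo $\sim$. For $s\in S$ let $Top^{\pm}(s)$ be the $U$-submodule generated by $e_s\pm e_{-s}$. Let $K$ be the number of $U$-orbits of primitive vectors. The form $h$ is said to be of type $\{r_1,\dots,r_m\}$ if it has matrix $\mathrm{diag}(r_1,\dots,r_m)$ in some basis of $V$. Then: (a) $Top^+=\bigoplus_{s\in S}Top^+(s)$ and $Top^-=\bigoplus_{s\in S}Top^-(s)$. (b) For each $s\in S$ and each sign $\pm$, there is exactly one linear character $\beta_s^{\pm}$ of $B(s)$ that extends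 $\beta_s$ and satisfies $\beta_s^{\pm}(\iota)=\pm1$; the $U$-module $Top^{\pm}(s)$ is irreducible, with character $\mathrm{ind}_{B(s)}^U\beta_s^{\pm}$. (c) The $U$-module $X$ is multiplicity free and has exactly $2K+1$ irreducible constituents: the trivial module, which is $Bot$, the $K$ modules $Top^+(s)$ and the $K$ modules $Top^-(s)$, $s\in S$. Here $K=q$ if $m>2$, or if $m=2$ and $h$ is of type $\{1,-1\}$; $K=q-1$ if $m=2$ and $h$ is of type $\{1,-\delta\}$, where $\delta\in F_q^\times$ is a non-square; and $K=(q-1)/2$ if $m=1$. -/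

import Mathlib

noncomputable section

namespace RamifiedWeil

/-! ### The ring `A = F[y]`, `y ^ 2 = 0`, its involution and its additive character -/

/-- The involution `(r + s y)* = r - s y` of `A = F[y]`, `y ^ 2 = 0`. -/
def conj (F : Type*) [Field F] : DualNumber F →+* DualNumber F where
  toFun a := TrivSqZeroExt.inl a.fst - TrivSqZeroExt.inr a.snd
  map_one' := by simp
  map_zero' := by simp
  map_mul' a b := by
    apply TrivSqZeroExt.ext
    · simp
    · simp
      ring
  map_add' a b := by
    apply TrivSqZeroExt.ext
    · simp
    · simp
      ring

@[simp] lemma conj_fst {F : Type*} [Field F] (a : DualNumber F) : (conj F a).fst = a.fst := by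
  simp [conj]

@[simp] lemma conj_snd {F : Type*} [Field F] (a : DualNumber F) : (conj F a).snd = -a.snd := by
  simp [conj]

/-- The additive map `d : A → F`, `d (r + s y) = 2 s`. -/
def dMap (F : Type*) [Field F] : DualNumber F →+ F where
  toFun a := 2 * a.snd
  map_zero' := by simp
  map_add' a b := by simp [mul_add]

/-- The character `μ (a) = λ (d a)` of the additive group of `A`. -/
def mu {F : Type*} [Field F] (lam : AddChar F ℂ) : AddChar (DualNumber F) ℂ :=
  lam.compAddMonoidHom (dMap F)

lemma mu_apply {F : Type*} [Field F] (lam : AddChar F ℂ) (a : DualNumber F) :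
    mu lam a = lam (2 * a.snd) := rfl

variable {F : Type*} [Field F] {V : Type*} [AddCommGroup V] [Module (DualNumber F) V]

/-! ### Hermitian forms and their unitary groups -/

variable (F V) in
/-- A `*`-hermitian form on the `A`-module `V`: linear in the second variable, conjugate-linear
in the first one, with `h (v, u) = h (u, v)*`. -/
structure HermitianForm where
  form : V →ₛₗ[conj F] V →ₗ[DualNumber F] DualNumber F
  symm : ∀ u v : V, form v u = conj F (form u v)

/-- `h` is non-degenerate: `v ↦ h (v, -)` is a bijection from `V` onto its dual. -/
def HermitianForm.Nondegenerate (h : HermitianForm F V) : Prop :=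
  Function.Bijective (fun v : V => h.form v)

/-- `h` is of type `{r₁, …, r_m}`: it has matrix `diag (r₁, …, r_m)` in some basis of `V`. -/
def HermitianForm.IsOfType (h : HermitianForm F V) {m : ℕ} (r : Fin m → F) : Prop :=
  ∃ b : Module.Basis (Fin m) (DualNumber F) V, ∀ i j : Fin m,
    h.form (b i) (b j) = if i = j then TrivSqZeroExt.inl (r i) else 0

/-- The unitary group `U` of `h`. -/
def U (h : HermitianForm F V) : Subgroup (V ≃ₗ[DualNumber F] V) where
  carrier := {g | ∀ u v : V, h.form (g u) (g v) = h.form u v}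
  one_mem' _ _ := rfl
  mul_mem' {a b} ha hb u v := by
    rw [LinearEquiv.mul_apply, LinearEquiv.mul_apply, ha, hb]
  inv_mem' {a} ha u v := by
    rw [← ha]
    simp [-LinearEquiv.mul_apply]

/-- The submodule `y V` of `V`. -/
def yV (F V : Type*) [Field F] [AddCommGroup V] [Module (DualNumber F) V] :
    Submodule (DualNumber F) V :=
  LinearMap.range (LinearMap.lsmul (DualNumber F) V DualNumber.eps)

lemma form_yV (h : HermitianForm F V) {u v : V} (hu : u ∈ yV F V) (hv : v ∈ yV F V) :
    h.form u v = 0 := by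
  obtain ⟨u, rfl⟩ := hu
  obtain ⟨v, rfl⟩ := hv
  have hc : conj F DualNumber.eps = -DualNumber.eps := by
    apply TrivSqZeroExt.ext <;> simp
  simp only [LinearMap.lsmul_apply, map_smulₛₗ, LinearMap.smul_apply, hc, smul_eq_mul,
    RingHom.id_apply]
  rw [← mul_assoc, mul_neg, DualNumber.eps_mul_eps, neg_zero, zero_mul]

lemma apply_mem_yV (g : V ≃ₗ[DualNumber F] V) {u : V} (hu : u ∈ yV F V) : g u ∈ yV F V := by
  obtain ⟨u, rfl⟩ := hu
  exact ⟨g u, by simp⟩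

/-- `v` is primitive if it does not belong to `y V`. -/
def Primitive (F : Type*) {V : Type*} [Field F] [AddCommGroup V] [Module (DualNumber F) V]
    (v : V) : Prop :=
  v ∉ yV F V

/-- The relation `v ∼ w`: some `g ∈ U` satisfies `g v ≡ w` modulo `y V`. -/
def Rel (h : HermitianForm F V) (v w : V) : Prop :=
  ∃ g : U h, g.1 v - w ∈ yV F V

/-- `S` is a set of representatives of the primitive vectors modulo `∼`. -/
def IsRepresentativeSet (h : HermitianForm F V) (S : Set V) : Prop :=
  (∀ s ∈ S, Primitive F s) ∧ ∀ v : V, Primitive F v → ∃! s : V, s ∈ S ∧ Rel h v s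

/-- The number `K` of `U`-orbits of primitive vectors. -/
def numOrbits (h : HermitianForm F V) : ℕ :=
  Set.ncard {O : Set V | ∃ v : V, Primitive F v ∧ O = Set.range (fun g : U h => g.1 v)}

/-- The central involution `v ↦ -v` of `U`. -/
def iota (h : HermitianForm F V) : U h :=
  ⟨LinearEquiv.neg (DualNumber F), fun u v => by simp⟩

lemma iota_comm (h : HermitianForm F V) (g : U h) : g * iota h = iota h * g := by
  ext v
  simp [iota]

/-- The group `N` of norm-one elements `z` of `A`, as the group of all `v ↦ z v` in `U`. -/
def normOne (h : HermitianForm F V) : Subgroup (U h) where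
  carrier := {g | ∃ z : DualNumber F, z * conj F z = 1 ∧ ∀ v : V, g.1 v = z • v}
  one_mem' := ⟨1, by simp, fun v => by simp⟩
  mul_mem' := by
    rintro a b ⟨z, hz, ha⟩ ⟨w, hw, hb⟩
    refine ⟨z * w, ?_, fun v => ?_⟩
    · rw [map_mul, mul_mul_mul_comm, hz, hw, mul_one]
    · simp [ha, hb, mul_smul]
  inv_mem' := by
    rintro a ⟨z, hz, ha⟩
    refine ⟨conj F z, ?_, fun v => ?_⟩
    · rw [← map_mul, hz, map_one]
    · apply a.1.injective
      rw [ha (conj F z • v), smul_smul, hz, one_smul]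
      simp [-LinearEquiv.mul_apply]

/-- The subgroup `C(v)` of all `g ∈ U` with `g v ≡ v` modulo `y V`. -/
def C (h : HermitianForm F V) (v : V) : Subgroup (U h) where
  carrier := {g | g.1 v - v ∈ yV F V}
  one_mem' := by simp
  mul_mem' {a b} ha hb := by
    have := (yV F V).add_mem (apply_mem_yV a.1 hb) ha
    simpa using this
  inv_mem' {a} ha := by
    have := (yV F V).neg_mem (apply_mem_yV (a⁻¹).1 ha)
    simpa [← LinearEquiv.mul_apply] using this

/-- The subgroup `B(v) = C(v) N` (as `N` is central in `U`, the join is the product). -/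
def B (h : HermitianForm F V) (v : V) : Subgroup (U h) := C h v ⊔ normOne h

lemma iota_mem_B (h : HermitianForm F V) (v : V) : iota h ∈ B h v :=
  (le_sup_right : normOne h ≤ B h v) ⟨-1, by simp, fun v => by simp [iota]⟩

lemma mu_form_self (lam : AddChar F ℂ) (h : HermitianForm F V) (v : V) :
    mu lam (h.form v v) = 1 := by
  have h2 := congrArg TrivSqZeroExt.snd (h.symm v v)
  rw [conj_snd] at h2
  have h3 : 2 * (h.form v v).snd = 0 := by linear_combination h2
  rw [mu_apply, h3, AddChar.map_zero_eq_one]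

/-- The linear character `β_v` of `C(v)`, given by `β_v (g) = μ (h (g v, v))`. -/
def beta (lam : AddChar F ℂ) (h : HermitianForm F V) (v : V) : C h v →* ℂ where
  toFun g := mu lam (h.form (g.1.1 v) v)
  map_one' := mu_form_self lam h v
  map_mul' a b := by
    have ha : h.form (a.1.1 (b.1.1 v - v)) (a.1.1 v - v) = 0 :=
      form_yV h (apply_mem_yV a.1.1 b.2) a.2
    have h1 : h.form (a.1.1 (b.1.1 v - v)) (a.1.1 v) = h.form (b.1.1 v - v) v := a.1.2 _ _
    have h2 : h.form (a.1.1 (b.1.1 v)) v + h.form v v =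
        h.form (a.1.1 v) v + h.form (b.1.1 v) v := by
      rw [map_sub, h1] at ha
      simp only [map_sub, LinearMap.sub_apply] at ha
      linear_combination -ha
    have h3 := congrArg (mu lam) h2
    rw [AddChar.map_add_eq_mul, AddChar.map_add_eq_mul, mu_form_self, mul_one] at h3
    exact h3

/-- `β` is the extension of `β_v` from `C(v)` to `B(v)` with `β (ι) = ε`; for `ε = ±1` this is
the linear character `β_v^±`. -/
def IsBetaExtension (lam : AddChar F ℂ) (h : HermitianForm F V) (v : V) (ε : ℤˣ)
    (β : B h v →* ℂ) : Prop :=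
  (∀ g : C h v, β ⟨g.1, (le_sup_left : C h v ≤ B h v) g.2⟩ = beta lam h v g) ∧
    β ⟨iota h, iota_mem_B h v⟩ = ((ε : ℤ) : ℂ)

/-! ### Generalities on complex representations -/

/-- The one-dimensional representation afforded by a linear character. -/
def linRep {G : Type*} [Group G] (χ : G →* ℂ) : Representation ℂ G ℂ :=
  (algebraMap ℂ (Module.End ℂ ℂ)).toMonoidHom.comp χ

/-- The subrepresentation generated by a vector. -/
def generated {G X : Type*} [Group G] [AddCommGroup X] [Module ℂ X] (ρ : Representation ℂ G X)
    (x : X) : Subrepresentation ρ where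
  toSubmodule := Submodule.span ℂ (Set.range fun g : G => ρ g x)
  apply_mem_toSubmodule g v hv := by
    have hle : Submodule.span ℂ (Set.range fun g : G => ρ g x) ≤
        (Submodule.span ℂ (Set.range fun g : G => ρ g x)).comap (ρ g) := by
      rw [Submodule.span_le]
      rintro _ ⟨k, rfl⟩
      exact Submodule.subset_span ⟨g * k, by simp⟩
    exact hle hv

/-- A complex representation `ρ` of a finite group is multiplicity free if each irreducible
representation `σ` occurs at most once in it: `dim Hom_G (σ, ρ) ≤ 1`. -/
def IsMultiplicityFree {G X : Type*} [Group G] [AddCommGroup X] [Module ℂ X]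
    (ρ : Representation ℂ G X) : Prop :=
  ∀ (E : Type) [AddCommGroup E] [Module ℂ E] (σ : Representation ℂ G E), σ.IsIrreducible →
    Module.rank ℂ (σ.IntertwiningMap ρ) ≤ 1

/-! ### The Heisenberg group and the Weil module -/

/-- The Heisenberg group `H = A × V` of `h`. -/
@[ext]
structure Heisenberg (h : HermitianForm F V) where
  fst : DualNumber F
  snd : V

namespace Heisenberg

variable {h : HermitianForm F V}

instance : Mul (Heisenberg h) := ⟨fun a b => ⟨a.fst + b.fst + h.form a.snd b.snd, a.snd + b.snd⟩⟩
instance : One (Heisenberg h) := ⟨⟨0, 0⟩⟩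
instance : Inv (Heisenberg h) := ⟨fun a => ⟨-a.fst + h.form a.snd a.snd, -a.snd⟩⟩

@[simp] lemma mul_fst (a b : Heisenberg h) :
    (a * b).fst = a.fst + b.fst + h.form a.snd b.snd := rfl
@[simp] lemma mul_snd (a b : Heisenberg h) : (a * b).snd = a.snd + b.snd := rfl
@[simp] lemma one_fst : (1 : Heisenberg h).fst = 0 := rfl
@[simp] lemma one_snd : (1 : Heisenberg h).snd = 0 := rfl
@[simp] lemma inv_fst (a : Heisenberg h) : (a⁻¹).fst = -a.fst + h.form a.snd a.snd := rfl
@[simp] lemma inv_snd (a : Heisenberg h) : (a⁻¹).snd = -a.snd := rfl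

instance : Group (Heisenberg h) := Group.ofLeftAxioms
  (fun a b c => by
    ext1
    · simp only [mul_fst, mul_snd, map_add, LinearMap.add_apply]
      abel
    · simp [add_assoc])
  (fun a => by ext1 <;> simp)
  (fun a => by ext1 <;> simp)

end Heisenberg

/-- The action of `U` on `H` by automorphisms, `g (a, v) = (a, g v)`. -/
def heisenbergAction (h : HermitianForm F V) : U h →* MulAut (Heisenberg h) where
  toFun g :=
    { toFun := fun a => ⟨a.fst, g.1 a.snd⟩
      invFun := fun a => ⟨a.fst, (g⁻¹).1 a.snd⟩
      left_inv := fun a => by ext1 <;> simp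
      right_inv := fun a => by ext1 <;> simp
      map_mul' := fun a b => by
        ext1
        · simp [g.2 a.snd b.snd]
        · simp }
  map_one' := rfl
  map_mul' _ _ := rfl

/-- The group `H ⋊ U`. -/
abbrev HU (h : HermitianForm F V) : Type _ := Heisenberg h ⋊[heisenbergAction h] U h

/-- The subgroup `(A, y V) ⋊ U` of `H ⋊ U`. -/
def AyVU (h : HermitianForm F V) : Subgroup (HU h) where
  carrier := {x | x.left.snd ∈ yV F V}
  one_mem' := (yV F V).zero_mem
  mul_mem' {x _} hx hz := (yV F V).add_mem hx (apply_mem_yV x.right.1 hz)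
  inv_mem' {x} hx := apply_mem_yV (x.right⁻¹).1 ((yV F V).neg_mem hx)

/-- The linear character `(a, u) g ↦ μ (a)` of `(A, y V) ⋊ U`. -/
def muExt (lam : AddChar F ℂ) (h : HermitianForm F V) : AyVU h →* ℂ where
  toFun x := mu lam x.1.left.fst
  map_one' := AddChar.map_zero_eq_one _
  map_mul' x z := by
    have h0 : h.form x.1.left.snd (x.1.right.1 z.1.left.snd) = 0 :=
      form_yV h x.2 (apply_mem_yV _ z.2)
    change mu lam (x.1.left.fst + z.1.left.fst +
      h.form x.1.left.snd (x.1.right.1 z.1.left.snd)) = _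
    rw [h0, add_zero, AddChar.map_add_eq_mul]

/-- The space `X` of the Weil module: the space of the representation of `H ⋊ U` induced from
the linear character `(a, u) g ↦ μ (a)` of `(A, y V) ⋊ U`. -/
abbrev X (lam : AddChar F ℂ) (h : HermitianForm F V) : Type _ :=
  Representation.IndV (AyVU h).subtype (linRep (muExt lam h))

/-- The Weil module `X` of `U`: the restriction to `U` of the induced representation of
`H ⋊ U`. -/
def weil (lam : AddChar F ℂ) (h : HermitianForm F V) : Representation ℂ (U h) (X lam h) :=
  (Representation.ind (AyVU h).subtype (linRep (muExt lam h))).comp SemidirectProduct.inr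

/-- The vector `e_v = (0, v) ⊗ ζ` of `X`. (In Mathlib's model of an induced module, the vector
`x ⊗ ζ` is the class of `x⁻¹ ⊗ ζ`.) -/
def e (lam : AddChar F ℂ) (h : HermitianForm F V) (v : V) : X lam h :=
  Representation.IndV.mk (AyVU h).subtype (linRep (muExt lam h))
    (SemidirectProduct.inl (⟨0, v⟩ : Heisenberg h))⁻¹ 1

lemma mk_mul (lam : AddChar F ℂ) (h : HermitianForm F V) (k : AyVU h) (x : HU h) :
    Representation.IndV.mk (AyVU h).subtype (linRep (muExt lam h)) ((k : HU h) * x) 1 =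
      muExt lam h k⁻¹ • Representation.IndV.mk (AyVU h).subtype (linRep (muExt lam h)) x 1 := by
  have h1 := Representation.Coinvariants.mk_self_apply
    (Representation.tprod ((Representation.leftRegular ℂ (HU h)).comp (AyVU h).subtype)
      (linRep (muExt lam h))) k (TensorProduct.mk ℂ _ _ (MonoidAlgebra.single x 1)
        (muExt lam h k⁻¹))
  have h2 : linRep (muExt lam h) k (muExt lam h k⁻¹) = 1 := by
    change muExt lam h k * muExt lam h k⁻¹ = 1
    rw [← map_mul, mul_inv_cancel, map_one]
  rw [← map_smul, smul_eq_mul, mul_one]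
  have h3 : linRep (muExt lam h) k (muExt lam h k)⁻¹ = 1 := by simpa using h2
  simpa [h3] using h1

/-- `U` permutes the vectors `e_v`. -/
lemma weil_e (lam : AddChar F ℂ) (h : HermitianForm F V) (g : U h) (v : V) :
    weil lam h g (e lam h v) = e lam h (g.1 v) := by
  let k : AyVU h := ⟨SemidirectProduct.inr g, (yV F V).zero_mem⟩⁻¹
  have hk : muExt lam h k⁻¹ = 1 := by
    rw [inv_inv]
    exact AddChar.map_zero_eq_one (mu lam)
  have hx : (SemidirectProduct.inl (⟨0, v⟩ : Heisenberg h) : HU h)⁻¹ *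
      (SemidirectProduct.inr g : HU h)⁻¹ =
      (k : HU h) * (SemidirectProduct.inl (⟨0, g.1 v⟩ : Heisenberg h) : HU h)⁻¹ := by
    change _ = (SemidirectProduct.inr g : HU h)⁻¹ * _
    rw [← mul_inv_rev, ← mul_inv_rev]
    refine congrArg (fun x : HU h => x⁻¹) ?_
    apply SemidirectProduct.ext
    · rw [SemidirectProduct.mul_left, SemidirectProduct.mul_left]
      change (1 : Heisenberg h) * ⟨0, g.1 v⟩ = ⟨0, g.1 v⟩ * 1
      ext1 <;> simp
    · rw [SemidirectProduct.mul_right, SemidirectProduct.mul_right]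
      simp
  have h1 := mk_mul lam h k (SemidirectProduct.inl (⟨0, g.1 v⟩ : Heisenberg h) : HU h)⁻¹
  rw [hk, one_smul, ← hx] at h1
  rw [e, e, ← h1]
  exact Representation.ind_mk _ _ _ _ _

/-- Translating `v` by an element of `y V` multiplies `e_v` by a scalar, so that `e_v`, for `v`
in a transversal of `y V` in `V`, span `X`. -/
lemma e_add (lam : AddChar F ℂ) (h : HermitianForm F V) (v u : V) (hu : u ∈ yV F V) :
    e lam h (v + u) = mu lam (-h.form v u) • e lam h v := by
  let k : AyVU h := ⟨SemidirectProduct.inl (⟨-h.form v u, u⟩ : Heisenberg h), hu⟩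
  have h1 := mk_mul lam h k⁻¹ (SemidirectProduct.inl (⟨0, v⟩ : Heisenberg h) : HU h)⁻¹
  rw [inv_inv] at h1
  have hx : (SemidirectProduct.inl (⟨0, v + u⟩ : Heisenberg h) : HU h)⁻¹ =
      ((k⁻¹ : AyVU h) : HU h) * (SemidirectProduct.inl (⟨0, v⟩ : Heisenberg h) : HU h)⁻¹ := by
    rw [Subgroup.coe_inv, ← mul_inv_rev]
    refine congrArg (fun x : HU h => x⁻¹) ?_
    change _ = (SemidirectProduct.inl _ : HU h) * SemidirectProduct.inl _
    rw [← map_mul]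
    refine congrArg _ ?_
    ext1 <;> simp
  rw [e, e, hx, h1]
  rfl

/-- `Top`, spanned by the `e_v` with `v` primitive. -/
def top (lam : AddChar F ℂ) (h : HermitianForm F V) : Subrepresentation (weil lam h) where
  toSubmodule := Submodule.span ℂ (e lam h '' {v | Primitive F v})
  apply_mem_toSubmodule g x hx := by
    have hle : Submodule.span ℂ (e lam h '' {v | Primitive F v}) ≤
        (Submodule.span ℂ (e lam h '' {v | Primitive F v})).comap (weil lam h g) := by
      rw [Submodule.span_le]
      rintro _ ⟨v, hv, rfl⟩
      refine Submodule.subset_span ⟨g.1 v, ?_, (weil_e lam h g v).symm⟩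
      exact fun hgv => hv (by simpa [← LinearEquiv.mul_apply] using apply_mem_yV (g⁻¹).1 hgv)
    exact hle hx

/-- `Bot`, spanned by the `e_v` with `v` not primitive. -/
def bot (lam : AddChar F ℂ) (h : HermitianForm F V) : Subrepresentation (weil lam h) where
  toSubmodule := Submodule.span ℂ (e lam h '' {v | ¬ Primitive F v})
  apply_mem_toSubmodule g x hx := by
    have hle : Submodule.span ℂ (e lam h '' {v | ¬ Primitive F v}) ≤
        (Submodule.span ℂ (e lam h '' {v | ¬ Primitive F v})).comap (weil lam h g) := by
      rw [Submodule.span_le]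
      rintro _ ⟨v, hv, rfl⟩
      refine Submodule.subset_span ⟨g.1 v, ?_, (weil_e lam h g v).symm⟩
      exact not_not_intro (apply_mem_yV g.1 (not_not.mp hv))
    exact hle hx

/-- `Top^±`, the eigenspace of `ι` acting on `Top` for the eigenvalue `ε = ±1`. -/
def topSign (lam : AddChar F ℂ) (h : HermitianForm F V) (ε : ℤˣ) :
    Subrepresentation (weil lam h) where
  toSubmodule := (top lam h).toSubmodule ⊓
    Module.End.eigenspace (weil lam h (iota h)) ((ε : ℤ) : ℂ)
  apply_mem_toSubmodule g x hx := by
    refine ⟨(top lam h).apply_mem_toSubmodule g hx.1, ?_⟩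
    have h1 := Module.End.mem_eigenspace_iff.mp hx.2
    refine Module.End.mem_eigenspace_iff.mpr ?_
    rw [← Module.End.mul_apply, ← map_mul, ← iota_comm, map_mul, Module.End.mul_apply, h1, map_smul]

/-- `Top^±(s)`, the `U`-submodule generated by `e_s ± e_{-s}`. -/
def topSignAt (lam : AddChar F ℂ) (h : HermitianForm F V) (ε : ℤˣ) (s : V) :
    Subrepresentation (weil lam h) :=
  generated (weil lam h) (e lam h s + ((ε : ℤ) : ℂ) • e lam h (-s))

end RamifiedWeil

end

noncomputable section

namespace RamifiedWeil

/-! ### Monomial representations -/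

section Monomial

variable {G : Type*} [Group G] {K : Subgroup G} (χ : K →* ℂ)

/-! The lines spanned by the `e_v` depend only on `v` modulo `yV`, decompose `X`, and are permuted
by `U`. The group `C(v)` acts on `e_v`, and on `e_{-v} = ι e_v`, through `β_v`. The key point is
that these characters separate classes up to sign. The transvections `x ↦ x + t y h(u, x) u` lie in
every `C(v)`, and `β_v` takes there the value `λ(-2 t r²)`, where `r` is the residue of `h(u, v)`.
If `w ≢ ±v`, some `u` pairs nontrivially with both `w - v` and `w + v`, so some `t` makes the two
values differ (`exists_beta_ne`). Hence the vectors of `X` on which `C(v)` acts by `β_v` are the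
combinations of `e_v` and `e_{-v}` (`mem_span_pair_of_weil_eq`), and prescribing the eigenvalue of
`ι` leaves a single line, that of `e_v ± e_{-v}`.

Now let `P` be a nonzero submodule. Take a vector of `P` with nonzero coordinate at some `v`,
average it against `β_v` over `C(v)`, and split it under `ι`: the result is a nonzero multiple of
some `e_v ± e_{-v}` in `P` (`exists_eSign_mem`). Irreducibility, the list of constituents and
multiplicity freeness all follow, because the sign is read off from `ι` and the orbit of `v` from
the support. The stabiliser of the line of `e_s ± e_{-s}` is `B(s)`, which gives the induced
character.

The count rests on Witt's theorem (`exists_apply_eq`): orbits of primitive vectors correspond to the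
values of the residual quadratic form over `F` at nonzero vectors. -/

lemma linRep_apply (k : K) (a : ℂ) : linRep χ k a = χ k * a := rfl

lemma indMk_apply (x : G) (a : ℂ) :
    Representation.IndV.mk K.subtype (linRep χ) x a =
      a • Representation.IndV.mk K.subtype (linRep χ) x 1 := by
  rw [← map_smul, smul_eq_mul, mul_one]

/-- The defining relation of the coinvariants. The class of `x` stands for `x⁻¹ ⊗ 1`, so `K` acts on
labels from the left. -/
lemma smul_indMk_mul (k : K) (x : G) :
    χ k • Representation.IndV.mk K.subtype (linRep χ) ((k : G) * x) 1 =
      Representation.IndV.mk K.subtype (linRep χ) x 1 := by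
  have h1 := Representation.Coinvariants.mk_self_apply
    (Representation.tprod ((Representation.leftRegular ℂ G).comp K.subtype)
      (linRep χ)) k (TensorProduct.mk ℂ _ _ (MonoidAlgebra.single x 1) 1)
  rw [← indMk_apply]
  simpa [linRep_apply] using h1

/-- Linear maps out of a representation induced from a linear character. -/
def indLift {W : Type*} [AddCommGroup W] [Module ℂ W] (f : G → W)
    (hf : ∀ (k : K) (x : G), χ k • f ((k : G) * x) = f x) :
    Representation.IndV K.subtype (linRep χ) →ₗ[ℂ] W :=
  Representation.Coinvariants.lift _
    (TensorProduct.lift <| (Finsupp.lift _ _ _ fun x => LinearMap.toSpanSingleton ℂ W (f x)) ∘ₗ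
      (MonoidAlgebra.coeffLinearEquiv ℂ).toLinearMap)
    fun k => by
      ext x
      simp [linRep_apply, hf]

lemma indLift_mk {W : Type*} [AddCommGroup W] [Module ℂ W] (f : G → W)
    (hf : ∀ (k : K) (x : G), χ k • f ((k : G) * x) = f x) (x : G) (a : ℂ) :
    indLift χ f hf (Representation.IndV.mk K.subtype (linRep χ) x a) = a • f x := by
  simp [indLift]

variable {X : Type*} [AddCommGroup X] [Module ℂ X] (ρ : Representation ℂ G X)

/-- The sum is the unnormalised projection onto the `χ`-isotypic part for `K`. -/
lemma map_sum_isotypic [Fintype K] (x : X) (k : K) :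
    ρ k (∑ g : K, χ g⁻¹ • ρ g x) = χ k • ∑ g : K, χ g⁻¹ • ρ g x := by
  rw [map_sum, Finset.smul_sum, ← Equiv.sum_comp (Equiv.mulLeft k) (fun g => χ k • χ g⁻¹ • ρ g x)]
  refine Finset.sum_congr rfl fun g _ => ?_
  have h1 : χ k * χ (k * g)⁻¹ = χ g⁻¹ := by
    rw [mul_inv_rev, mul_comm, ← map_mul, inv_mul_cancel_right]
  rw [map_smul, smul_smul, Equiv.coe_mulLeft, h1, ← Module.End.mul_apply, ← map_mul,
    Subgroup.coe_mul]

lemma mem_generated_self (x : X) : x ∈ (generated ρ x).toSubmodule :=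
  Submodule.subset_span ⟨1, by simp⟩

lemma generated_le {x : X} {P : Subrepresentation ρ} (hx : x ∈ P.toSubmodule) :
    (generated ρ x).toSubmodule ≤ P.toSubmodule := by
  refine Submodule.span_le.mpr ?_
  rintro _ ⟨g, rfl⟩
  exact P.apply_mem_toSubmodule g hx

/-- A vector `f` spanning a line stable under `K`, detected by a functional vanishing on the other
translates of `f`, generates the representation induced from the character of `K` on this line. -/
theorem nonempty_equiv_ind [Finite G] (f : X) (φ : X →ₗ[ℂ] ℂ) (hφ : φ f = 1)
    (h0 : ∀ g, g ∉ K → φ (ρ g f) = 0) (hf : ∀ k : K, ρ k f = χ k • f) :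
    Nonempty ((Representation.ind K.subtype (linRep χ)).Equiv
      (generated ρ f).toRepresentation) := by
  classical
  have := Fintype.ofFinite G
  have hlift : ∀ (k : K) (x : G), χ k • ρ ((k : G) * x)⁻¹ f = ρ x⁻¹ f := fun k x => by
    have h1 := hf k⁻¹
    rw [mul_inv_rev, map_mul, Module.End.mul_apply, ← map_smul, ← K.coe_inv, h1, smul_smul,
      ← map_mul, mul_inv_cancel, map_one, one_smul]
  let Φ := indLift χ (fun x => ρ x⁻¹ f) hlift
  -- `Ψ` inverts `Φ` up to a scalar: `φ` detects the coset of each translate of `f`, and each coset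
  -- is met `|K|` times. This gives injectivity of `Φ` without counting dimensions.
  let Ψ : X →ₗ[ℂ] Representation.IndV K.subtype (linRep χ) :=
    ∑ g : G, (φ ∘ₗ ρ g).smulRight (Representation.IndV.mk K.subtype (linRep χ) g 1)
  let E : G → Representation.IndV K.subtype (linRep χ) :=
    fun g => Representation.IndV.mk K.subtype (linRep χ) g 1
  have hΨsum : ∀ z, Ψ z = ∑ g : G, φ (ρ g z) • E g := fun z => LinearMap.sum_apply _ _ _
  have hΨ : ∀ x a, Ψ (Φ (Representation.IndV.mk K.subtype (linRep χ) x a)) =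
      (Fintype.card K : ℂ) • Representation.IndV.mk K.subtype (linRep χ) x a := by
    intro x a
    rw [indLift_mk, indMk_apply χ x a, map_smul, smul_comm]
    congr 1
    rw [hΨsum, ← Equiv.sum_comp (Equiv.mulRight x)]
    have h1 : ∀ g ∈ Finset.univ, g ∉ Finset.univ.filter (· ∈ K) →
        φ (ρ (Equiv.mulRight x g) (ρ x⁻¹ f)) • E (Equiv.mulRight x g) = 0 := by
      intro g _ hg
      rw [Equiv.coe_mulRight, ← Module.End.mul_apply, ← map_mul, mul_inv_cancel_right,
        h0 g (by simpa using hg), zero_smul]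
    rw [← Finset.sum_subset (Finset.subset_univ _) h1,
      Finset.sum_subtype (p := (· ∈ K)) (Finset.univ.filter (· ∈ K)) (by simp)]
    have h2 : ∀ k : K, φ (ρ (Equiv.mulRight x (k : G)) (ρ x⁻¹ f)) • E (Equiv.mulRight x k) =
        E x := by
      intro k
      rw [Equiv.coe_mulRight, ← Module.End.mul_apply, ← map_mul, mul_inv_cancel_right,
        hf, map_smul, hφ, smul_eq_mul, mul_one, smul_indMk_mul]
    rw [Finset.sum_congr rfl fun k _ => h2 k, Finset.sum_const, Finset.card_univ,
      Nat.cast_smul_eq_nsmul]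
  have hΨ' : Ψ ∘ₗ Φ = (Fintype.card K : ℂ) • LinearMap.id :=
    Representation.IndV.hom_ext _ _ fun x => LinearMap.ext fun a => by simpa using hΨ x a
  have hinj : Function.Injective Φ := by
    have hc : (Fintype.card K : ℂ) ≠ 0 := Nat.cast_ne_zero.mpr Fintype.card_ne_zero
    refine Function.Injective.of_comp (f := Ψ) fun x y hxy => ?_
    have h1 := LinearMap.congr_fun hΨ' x
    have h2 := LinearMap.congr_fun hΨ' y
    exact smul_right_injective _ hc (by
      simpa using (h1.symm.trans (by simpa using hxy)).trans h2)
  have hrange : LinearMap.range Φ = (generated ρ f).toSubmodule := by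
    apply le_antisymm
    · rintro _ ⟨z, rfl⟩
      have : (⊤ : Submodule ℂ _) ≤ (generated ρ f).toSubmodule.comap Φ := by
        rw [← Submodule.map_le_iff_le_comap, ← LinearMap.range_eq_map]
        -- Passing to the quotient turns the inclusion into an equality of linear maps, which can be
        -- checked on generators.
        have h3 : (generated ρ f).toSubmodule.mkQ ∘ₗ Φ = 0 :=
          Representation.IndV.hom_ext _ _ fun x => LinearMap.ext fun a => by
            refine (Submodule.Quotient.mk_eq_zero _).mpr ?_
            rw [indLift_mk]
            exact Submodule.smul_mem _ _ (Submodule.subset_span ⟨x⁻¹, rfl⟩)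
        rintro _ ⟨z, rfl⟩
        exact (Submodule.Quotient.mk_eq_zero _).mp (LinearMap.congr_fun h3 z)
      exact this Submodule.mem_top
    · refine Submodule.span_le.mpr ?_
      rintro _ ⟨g, rfl⟩
      exact ⟨Representation.IndV.mk K.subtype (linRep χ) g⁻¹ 1, by
        rw [indLift_mk, one_smul, inv_inv]⟩
  refine ⟨Representation.Equiv.mk ((LinearEquiv.ofInjective Φ hinj).trans
    (LinearEquiv.ofEq _ _ hrange)) fun g => ?_⟩
  refine Representation.IndV.hom_ext _ _ fun x => LinearMap.ext fun a => Subtype.ext ?_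
  change Φ (Representation.ind K.subtype (linRep χ) g
    (Representation.IndV.mk K.subtype (linRep χ) x a)) =
    ρ g (Φ (Representation.IndV.mk K.subtype (linRep χ) x a))
  rw [Representation.ind_mk, indLift_mk, indLift_mk, map_smul, mul_inv_rev, inv_inv, map_mul,
    Module.End.mul_apply]

/-- A subrepresentation is irreducible if and only if it is minimal among the nonzero ones. -/
lemma isIrreducible_iff (P : Subrepresentation ρ) :
    P.toRepresentation.IsIrreducible ↔ P.toSubmodule ≠ ⊥ ∧
      ∀ Q : Subrepresentation ρ, Q.toSubmodule ≤ P.toSubmodule → Q.toSubmodule ≠ ⊥ →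
        Q.toSubmodule = P.toSubmodule := by
  constructor
  · intro hP
    refine ⟨fun h0 => ?_, fun Q hQ hQ0 => ?_⟩
    · obtain ⟨a, b, hab⟩ := hP.toNontrivial
      refine hab (Subrepresentation.toSubmodule_injective ?_)
      ext ⟨z, hz⟩
      have hz0 : z = 0 := by simpa [h0] using hz
      subst hz0
      exact ⟨fun _ => b.toSubmodule.zero_mem, fun _ => a.toSubmodule.zero_mem⟩
    · let Q' : Subrepresentation P.toRepresentation :=
        ⟨Q.toSubmodule.comap P.toSubmodule.subtype, fun g v hv =>
          Q.apply_mem_toSubmodule g hv⟩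
      rcases hP.eq_bot_or_eq_top Q' with h1 | h1
      · refine absurd ?_ hQ0
        rw [eq_bot_iff]
        intro z hz
        have h2 : (⟨z, hQ hz⟩ : P.toSubmodule) ∈ Q'.toSubmodule := hz
        rw [h1] at h2
        exact congrArg Subtype.val ((Submodule.mem_bot ℂ).mp h2)
      · refine le_antisymm hQ fun z hz => ?_
        have h2 : (⟨z, hz⟩ : P.toSubmodule) ∈ Q'.toSubmodule := by
          rw [h1]
          exact Submodule.mem_top
        exact h2
  · rintro ⟨h0, hmin⟩
    obtain ⟨z, hz, hz0⟩ := Submodule.exists_mem_ne_zero_of_ne_bot h0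
    refine { exists_pair_ne := ⟨⊥, ⊤, fun h => ?_⟩, eq_bot_or_eq_top := fun Q => ?_ }
    · have h2 : (⟨z, hz⟩ : P.toSubmodule) ∈
          (⊥ : Subrepresentation P.toRepresentation).toSubmodule := by
        rw [h]
        exact Submodule.mem_top
      exact hz0 (congrArg Subtype.val ((Submodule.mem_bot ℂ).mp h2))
    · let Q' : Subrepresentation ρ := ⟨Q.toSubmodule.map P.toSubmodule.subtype, by
        rintro g _ ⟨v, hv, rfl⟩
        exact ⟨_, Q.apply_mem_toSubmodule g hv, rfl⟩⟩
      by_cases hQ : Q'.toSubmodule = ⊥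
      · left
        refine Subrepresentation.toSubmodule_injective ?_
        exact Submodule.map_injective_of_injective (Submodule.subtype_injective _)
          (hQ.trans (Submodule.map_bot _).symm)
      · right
        have h1 := hmin Q' (Submodule.map_subtype_le _ _) hQ
        refine Subrepresentation.toSubmodule_injective ?_
        refine eq_top_iff.mpr fun w _ => ?_
        have h2 : (w : X) ∈ Q'.toSubmodule := by
          rw [h1]
          exact w.2
        obtain ⟨w', hw', hww⟩ := h2
        rwa [← Subtype.ext hww]

/-- A representation is multiplicity free if every nonzero subrepresentation contains a nonzero
vector that is determined up to scalars by a family of eigenvector equations. -/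
theorem isMultiplicityFree_of_eigenlines
    (H : ∀ P : Subrepresentation ρ, P.toSubmodule ≠ ⊥ → ∃ f ∈ P.toSubmodule, f ≠ 0 ∧
      ∃ T : Set (G × ℂ), (∀ t ∈ T, ρ t.1 f = t.2 • f) ∧
        ∀ x, (∀ t ∈ T, ρ t.1 x = t.2 • x) → x ∈ Submodule.span ℂ {f}) :
    IsMultiplicityFree ρ := by
  intro E _ _ σ hσ
  rw [rank_le_one_iff]
  by_cases h0 : ∀ φ : σ.IntertwiningMap ρ, φ = 0
  · exact ⟨0, fun φ => ⟨0, by rw [h0 φ, smul_zero]⟩⟩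
  push Not at h0
  obtain ⟨φ, hφ⟩ := h0
  have hinj := (Representation.IsIrreducible.injective_or_eq_zero φ).resolve_right hφ
  have hrange : φ.range.toSubmodule ≠ ⊥ := by
    intro hc
    apply hφ
    refine Representation.IntertwiningMap.ext (LinearMap.ext fun x => ?_)
    have h1 : φ x ∈ φ.range.toSubmodule := ⟨x, rfl⟩
    rw [hc] at h1
    exact (Submodule.mem_bot ℂ).mp h1
  obtain ⟨f, ⟨x, hx⟩, hf0, T, hT, hspan⟩ := H _ hrange
  replace hx : φ x = f := hx
  -- The preimage `x` of `f` satisfies the eigenvector equations because `φ` is injective. So `ψ x`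
  -- satisfies them too and equals `c • f`; then `c • φ - ψ` kills `x ≠ 0` and vanishes by Schur's
  -- lemma.
  refine ⟨φ, fun ψ => ?_⟩
  have hxT : ∀ t ∈ T, σ t.1 x = t.2 • x := fun t ht => hinj (by
    rw [φ.isIntertwining, map_smul, hx, hT t ht])
  obtain ⟨c, hc⟩ := Submodule.mem_span_singleton.mp (hspan (ψ x) fun t ht => by
    rw [← ψ.isIntertwining, hxT t ht, map_smul])
  refine ⟨c, ?_⟩
  have h1 : (c • φ - ψ) x = 0 := by
    rw [Representation.IntertwiningMap.coe_sub, Pi.sub_apply,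
      Representation.IntertwiningMap.coe_smul, Pi.smul_apply, hx, hc, sub_self]
  rcases Representation.IsIrreducible.injective_or_eq_zero (c • φ - ψ) with h3 | h3
  · have hx0 : x = 0 := h3 (by rw [h1, map_zero])
    rw [hx0, map_zero] at hx
    exact absurd hx.symm hf0
  · exact sub_eq_zero.mp h3

/-- The character through which a subgroup acts on a stable line. -/
lemma exists_character_of_stable_line (K : Subgroup G) {f : X} (hf0 : f ≠ 0)
    (hf : ∀ k ∈ K, ∃ c : ℂ, ρ k f = c • f) : ∃ β : K →* ℂ, ∀ k : K, ρ k f = β k • f := by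
  choose! c hc using hf
  refine ⟨⟨⟨fun k => c k, ?_⟩, fun a b => ?_⟩, fun k => hc k k.2⟩
  · have h1 := hc 1 K.one_mem
    rw [map_one, Module.End.one_apply] at h1
    exact smul_left_injective ℂ hf0 (h1.symm.trans (one_smul ℂ f).symm)
  · refine smul_left_injective ℂ hf0 ?_
    change c (a * b : K) • f = (c a * c b) • f
    rw [← hc _ (a * b).2, Subgroup.coe_mul, map_mul, Module.End.mul_apply, hc _ b.2, map_smul,
      hc _ a.2, smul_smul, mul_comm]

lemma smul_add_smul_of_mul_self {c : ℂ} (hc : c * c = 1) (x y : X) :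
    y + c • x = c • (x + c • y) := by
  rw [smul_add, smul_smul, hc, one_smul, add_comm]

lemma mem_of_add_smul_mem {P : Submodule ℂ X} {c : ℂ} (hc : c * c = 1) {x y : X}
    (hy : y = c • x) (hP : x + c • y ∈ P) : x ∈ P := by
  rw [hy, smul_smul, hc, one_smul, ← two_smul ℂ] at hP
  exact (Submodule.smul_mem_iff P two_ne_zero).mp hP

/-- Write `x` as half of `x + c • (c • x)` and substitute the two expressions in `p` and `q`. -/
lemma eq_smul_of_involution {a b c : ℂ} (hc : c * c = 1) {x p q : X} (hx : a • p + b • q = x)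
    (hcx : b • p + a • q = c • x) : (2⁻¹ * (a + c * b)) • (p + c • q) = x := by
  have h1 : (2 : ℂ) • x = x + c • c • x := by rw [smul_smul, hc, one_smul, two_smul]
  rw [← hcx] at h1
  nth_rewrite 2 [← hx] at h1
  have h3 : (a + c * b) • (p + c • q) = a • p + b • q + c • (b • p + a • q) := by
    have h4 : (c * b * c) • q = b • q := by rw [mul_right_comm, hc, one_mul]
    rw [← h4]
    module
  rw [mul_smul, h3, ← h1, inv_smul_smul₀ two_ne_zero]

lemma eq_zero_of_add_of_sub {x y : X} (h1 : x + y = 0) (h2 : x - y = 0) : x = 0 := by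
  have h3 : (2 : ℂ) • x = 0 := by
    rw [← sub_eq_zero.mp h2, ← two_smul ℂ] at h1
    exact h1
  exact (smul_eq_zero.mp h3).resolve_left two_ne_zero

lemma sign_mul_self (ε : ℤˣ) : ((ε : ℤ) : ℂ) * ((ε : ℤ) : ℂ) = 1 := by
  rw [← Int.cast_mul, ← Units.val_mul, Int.units_mul_self, Units.val_one, Int.cast_one]

/-- Since `i` is a central involution, `z + i z` and `z - i z` keep the `K`-eigenvector property.
They cannot both vanish, as their sum is `2 z`. -/
lemma exists_sign_eigenvector {i : G} (hi : i * i = 1) (hcomm : ∀ g, g * i = i * g)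
    {P : Subrepresentation ρ} {z : X} (hz : z ∈ P.toSubmodule) (hz0 : z ≠ 0)
    (hzK : ∀ k : K, ρ k z = χ k • z) :
    ∃ ε : ℤˣ, ∃ w ∈ P.toSubmodule, w ≠ 0 ∧ (∀ k : K, ρ k w = χ k • w) ∧
      ρ i w = ((ε : ℤ) : ℂ) • w := by
  have key : ∀ ε : ℤˣ, z + ((ε : ℤ) : ℂ) • ρ i z ≠ 0 → ∃ ε : ℤˣ, ∃ w ∈ P.toSubmodule, w ≠ 0 ∧
      (∀ k : K, ρ k w = χ k • w) ∧ ρ i w = ((ε : ℤ) : ℂ) • w := by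
    refine fun ε hne => ⟨ε, _, add_mem hz (Submodule.smul_mem _ _ (P.apply_mem_toSubmodule i hz)),
      hne, fun k => ?_, ?_⟩
    · rw [map_add, map_smul, ← Module.End.mul_apply, ← map_mul, hcomm, map_mul,
        Module.End.mul_apply, hzK, map_smul, smul_add, smul_comm]
    · rw [map_add, map_smul, ← Module.End.mul_apply, ← map_mul, hi, map_one, Module.End.one_apply]
      exact smul_add_smul_of_mul_self (sign_mul_self ε) _ _
  by_cases h1 : z + (((1 : ℤˣ) : ℤ) : ℂ) • ρ i z = 0
  · refine key (-1) fun h3 => hz0 ?_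
    rw [Units.val_one, Int.cast_one, one_smul] at h1
    rw [Units.val_neg, Units.val_one, Int.cast_neg, Int.cast_one, neg_one_smul,
      ← sub_eq_add_neg] at h3
    exact eq_zero_of_add_of_sub h1 h3
  · exact key 1 h1

end Monomial

/-! ### Geometry of the hermitian space -/

section Geometry

variable {F : Type*} [Field F] {V : Type*} [AddCommGroup V] [Module (DualNumber F) V]

/-- The symmetric bilinear form induced by `h` modulo `y V`. -/
def residue (h : HermitianForm F V) (u v : V) : F := (h.form u v).fst

variable {h : HermitianForm F V}

lemma residue_comm (u v : V) : residue h u v = residue h v u := by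
  rw [residue, residue, h.symm v u, conj_fst]

lemma residue_add_right (u v w : V) : residue h u (v + w) = residue h u v + residue h u w := by
  simp [residue]

lemma residue_add_left (u v w : V) : residue h (u + v) w = residue h u w + residue h v w := by
  simp [residue]

lemma residue_sub_right (u v w : V) : residue h u (v - w) = residue h u v - residue h u w := by
  simp [residue]

lemma residue_sub_left (u v w : V) : residue h (u - v) w = residue h u w - residue h v w := by
  simp [residue]

lemma residue_neg_right (u v : V) : residue h u (-v) = -residue h u v := by
  simp [residue]

lemma residue_neg_left (u v : V) : residue h (-u) v = -residue h u v := by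
  simp [residue]

lemma residue_smul_right (a : DualNumber F) (u v : V) :
    residue h u (a • v) = a.fst * residue h u v := by
  simp [residue]

lemma residue_smul_left (a : DualNumber F) (u v : V) :
    residue h (a • u) v = a.fst * residue h u v := by
  rw [residue_comm, residue_smul_right, residue_comm]

lemma residue_apply (g : U h) (u v : V) : residue h (g.1 u) (g.1 v) = residue h u v := by
  rw [residue, residue, g.2]

lemma smul_mem_yV {a : DualNumber F} (ha : a.fst = 0) (v : V) : a • v ∈ yV F V := by
  refine ⟨(TrivSqZeroExt.inl a.snd : DualNumber F) • v, ?_⟩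
  rw [LinearMap.lsmul_apply, smul_smul]
  congr 1
  apply TrivSqZeroExt.ext <;> simp [ha]

lemma mem_yV_of_functional [Module.Free (DualNumber F) V] {v : V}
    (hv : ∀ f : V →ₗ[DualNumber F] DualNumber F, (f v).fst = 0) : v ∈ yV F V := by
  let b := Module.Free.chooseBasis (DualNumber F) V
  rw [← b.linearCombination_repr v, Finsupp.linearCombination_apply]
  exact Submodule.sum_mem _ fun i _ => smul_mem_yV (hv (b.coord i)) _

lemma residue_of_mem_right (u : V) {v : V} (hv : v ∈ yV F V) : residue h u v = 0 := by
  obtain ⟨v, rfl⟩ := hv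
  rw [LinearMap.lsmul_apply, residue_smul_right, DualNumber.fst_eps, zero_mul]

/-- The residual form is nondegenerate on `V / yV`: every functional is some `h(u, -)`, and the
coordinate functionals detect `yV`. -/
lemma mem_yV_iff [Module.Free (DualNumber F) V] (hh : h.Nondegenerate) {v : V} :
    v ∈ yV F V ↔ ∀ u, residue h u v = 0 := by
  refine ⟨fun hv u => residue_of_mem_right u hv, fun hv => mem_yV_of_functional fun f => ?_⟩
  obtain ⟨u, rfl⟩ := hh.2 f
  exact hv u

lemma exists_residue_ne_zero [Module.Free (DualNumber F) V] (hh : h.Nondegenerate) {v : V}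
    (hv : Primitive F v) : ∃ u, residue h u v ≠ 0 := by
  by_contra! hc
  exact hv ((mem_yV_iff hh).mpr hc)

/-- Two proper subspaces do not cover the space: one of `a`, `b`, `a + b` avoids both. -/
lemma exists_residue_ne_zero_and [Module.Free (DualNumber F) V] (hh : h.Nondegenerate) {v w : V}
    (hv : Primitive F v) (hw : Primitive F w) : ∃ u, residue h u v ≠ 0 ∧ residue h u w ≠ 0 := by
  obtain ⟨a, ha⟩ := exists_residue_ne_zero hh hv
  obtain ⟨b, hb⟩ := exists_residue_ne_zero hh hw
  by_cases ha' : residue h a w = 0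
  · by_cases hb' : residue h b v = 0
    · exact ⟨a + b, by simpa [residue_add_left, hb'] using ha,
        by simpa [residue_add_left, ha'] using hb⟩
    · exact ⟨b, hb', hb⟩
  · exact ⟨a, ha, ha'⟩

/-- `h(v, v)` is fixed by the involution, so lengths lie in `F` and are determined by their
residues. -/
lemma form_self_snd (h2 : (2 : F) ≠ 0) (v : V) : (h.form v v).snd = 0 := by
  have h3 := congrArg TrivSqZeroExt.snd (h.symm v v)
  rw [conj_snd] at h3
  refine (mul_eq_zero.mp ?_).resolve_left h2
  linear_combination h3

lemma form_self_eq_iff (h2 : (2 : F) ≠ 0) {v w : V} :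
    h.form v v = h.form w w ↔ residue h v v = residue h w w :=
  ⟨fun hvw => congrArg TrivSqZeroExt.fst hvw, fun hvw =>
    TrivSqZeroExt.ext hvw (by rw [form_self_snd h2, form_self_snd h2])⟩

@[simp] lemma conj_conj (a : DualNumber F) : conj F (conj F a) = a := by
  apply TrivSqZeroExt.ext <;> simp

variable (h) in
/-- The linear map `x ↦ x + a h (u, x) u`. -/
def transvectionMap (u : V) (a : DualNumber F) : V →ₗ[DualNumber F] V :=
  LinearMap.id + (a • h.form u).smulRight u

lemma transvectionMap_apply (u : V) (a : DualNumber F) (x : V) :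
    transvectionMap h u a x = x + (a * h.form u x) • u := rfl

/-- The hypothesis on `a` is the condition for the map to preserve `h`; it also makes the map with
`a*` its inverse. -/
lemma transvectionMap_comp {u : V} {a : DualNumber F}
    (ha : a + conj F a + a * conj F a * h.form u u = 0) :
    transvectionMap h u (conj F a) ∘ₗ transvectionMap h u a = LinearMap.id := by
  ext x
  have h1 : (a * h.form u x) + (conj F a * (h.form u x + a * h.form u x * h.form u u)) = 0 := by
    linear_combination h.form u x * ha
  simp only [LinearMap.comp_apply, transvectionMap_apply, map_add, map_smul,
    LinearMap.id_apply]
  trans x + (a * h.form u x + conj F a * (h.form u x + a * h.form u x * h.form u u)) • u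
  · module
  · rw [h1, zero_smul, add_zero]

variable (h) in
/-- The unitary transformation `x ↦ x + a h (u, x) u`. -/
def transvection (u : V) (a : DualNumber F) (ha : a + conj F a + a * conj F a * h.form u u = 0) :
    U h :=
  ⟨LinearEquiv.ofLinearMap (transvectionMap h u a) (transvectionMap h u (conj F a))
    (by
      have h1 := transvectionMap_comp (h := h) (u := u) (a := conj F a)
        (by rw [conj_conj]; linear_combination ha)
      rwa [conj_conj] at h1) (transvectionMap_comp ha), fun x z => by
    simp only [LinearEquiv.coe_ofLinearMap, transvectionMap_apply, map_add, LinearMap.add_apply,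
      map_smulₛₗ, LinearMap.smul_apply, smul_eq_mul, map_mul, RingHom.id_apply]
    rw [h.symm u x]
    linear_combination (conj F (h.form u x) * h.form u z) * ha⟩

lemma transvection_apply (u : V) (a : DualNumber F)
    (ha : a + conj F a + a * conj F a * h.form u u = 0) (x : V) :
    (transvection h u a ha).1 x = x + (a * h.form u x) • u := rfl

/-- Use a reflection along `v - w`. With `p = h(v - w, v)`, a unit by the residue condition, the
coefficient `-p⁻¹` sends `v` to `v - (v - w)`. Equality of lengths gives `h(v - w, v - w) = p + p*`,
which is unitarity. -/
lemma exists_apply_eq_of_residue_ne {v w : V} (hvw : h.form v v = h.form w w)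
    (hne : residue h v w ≠ residue h v v) : ∃ g : U h, g.1 v = w := by
  set p := h.form (v - w) v with hp
  have hp0 : p.fst ≠ 0 := by
    change residue h (v - w) v ≠ 0
    rw [residue_sub_left, residue_comm w v]
    exact sub_ne_zero.mpr hne.symm
  have hq : p * p⁻¹ = 1 := TrivSqZeroExt.mul_inv_cancel hp0
  have hq' : conj F p * conj F p⁻¹ = 1 := by rw [← map_mul, hq, map_one]
  have hpp : h.form (v - w) (v - w) = p + conj F p := by
    rw [hp, ← h.symm]
    simp only [map_sub, LinearMap.sub_apply]
    linear_combination -hvw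
  refine ⟨transvection h (v - w) (-p⁻¹) ?_, ?_⟩
  · rw [hpp, map_neg]
    linear_combination (conj F p⁻¹) * hq + p⁻¹ * hq'
  · rw [transvection_apply, ← hp, neg_mul, mul_comm, hq]
    simp

/-- Witt's theorem for vectors: primitive vectors of the same length are conjugate under `U`. -/
theorem exists_apply_eq [Module.Free (DualNumber F) V] (hh : h.Nondegenerate) (h2 : (2 : F) ≠ 0)
    {v w : V} (hv : Primitive F v) (hw : Primitive F w) (hvw : residue h v v = residue h w w) :
    ∃ g : U h, g.1 v = w := by
  -- When one reflection is unavailable, two suffice, through an intermediate vector `z` of the same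
  -- length.
  have trans : ∀ z : V, residue h z z = residue h v v → residue h v z ≠ residue h v v →
      residue h z w ≠ residue h v v → ∃ g : U h, g.1 v = w := by
    intro z hz h1 h3
    obtain ⟨a, ha⟩ := exists_apply_eq_of_residue_ne ((form_self_eq_iff h2).mpr hz.symm) h1
    obtain ⟨b, hb⟩ := exists_apply_eq_of_residue_ne
      ((form_self_eq_iff h2).mpr (hz.trans hvw)) (hz ▸ h3)
    exact ⟨b * a, by simp [ha, hb]⟩
  by_cases hne : residue h v w = residue h v v
  swap
  · exact exists_apply_eq_of_residue_ne ((form_self_eq_iff h2).mpr hvw) hne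
  by_cases h0 : residue h v v = 0
  · obtain ⟨x, hxv, hxw⟩ := exists_residue_ne_zero_and hh hv hw
    -- This `t` makes `x + t v` residually isotropic. As `h(v, v)` and `h(v, w)` have residue zero,
    -- adding `t v` leaves the pairings of `x` with `v` and `w` unchanged modulo `y`.
    set t : F := -residue h x x / (2 * residue h x v) with ht
    have ht' : residue h x x + 2 * t * residue h x v = 0 := by
      rw [ht]
      field_simp
      ring
    refine trans (x + (TrivSqZeroExt.inl t : DualNumber F) • v) ?_ ?_ ?_
    · simp only [residue_add_left, residue_add_right, residue_smul_left, residue_smul_right,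
        TrivSqZeroExt.fst_inl, h0, residue_comm v x]
      linear_combination ht'
    · simpa [residue_add_right, residue_smul_right, h0, residue_comm v x] using hxv
    · simpa [residue_add_left, residue_smul_left, h0, hne] using hxw
  -- For nonzero length the intermediate vector is `-v`, which pairs with both `v` and `w` to minus
  -- the length.
  · have hneg : -residue h v v ≠ residue h v v := fun hc => h0 <|
      (mul_eq_zero.mp (by linear_combination -hc)).resolve_left h2
    refine trans (-v) ?_ ?_ ?_
    · simp [residue_neg_left, residue_neg_right]
    · simpa [residue_neg_right] using hneg
    · simpa [residue_neg_left, hne] using hneg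

lemma residue_self_add {v u : V} (hu : u ∈ yV F V) :
    residue h (v + u) (v + u) = residue h v v := by
  rw [residue_add_right, residue_of_mem_right _ hu, add_zero, residue_add_left,
    residue_comm u v, residue_of_mem_right _ hu, add_zero]

lemma Rel.residue_eq {v w : V} (hvw : Rel h v w) : residue h v v = residue h w w := by
  obtain ⟨g, hg⟩ := hvw
  rw [← residue_apply g v v, ← residue_self_add (h := h) (v := w) hg, add_sub_cancel]

lemma rel_iff [Module.Free (DualNumber F) V] (hh : h.Nondegenerate) (h2 : (2 : F) ≠ 0)
    {v w : V} (hv : Primitive F v) (hw : Primitive F w) :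
    Rel h v w ↔ residue h v v = residue h w w := by
  refine ⟨Rel.residue_eq, fun hvw => ?_⟩
  obtain ⟨g, hg⟩ := exists_apply_eq hh h2 hv hw hvw
  exact ⟨g, by simp [hg]⟩

lemma Primitive.apply {v : V} (hv : Primitive F v) (g : U h) : Primitive F (g.1 v) :=
  fun hgv => hv (by simpa [← LinearEquiv.mul_apply] using apply_mem_yV (g⁻¹).1 hgv)

lemma Primitive.neg {v : V} (hv : Primitive F v) : Primitive F (-v) :=
  fun h1 => hv (neg_mem_iff.mp h1)

/-- For `a = t y` both `a + a*` and `a a*` vanish, so the condition holds for every `u`. -/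
lemma transvection_condition (u : V) (t : F) :
    (TrivSqZeroExt.inr t : DualNumber F) + conj F (TrivSqZeroExt.inr t) +
      TrivSqZeroExt.inr t * conj F (TrivSqZeroExt.inr t) * h.form u u = 0 := by
  apply TrivSqZeroExt.ext <;> simp

variable (h) in
/-- The transvection `x ↦ x + t y h (u, x) u`, congruent to the identity modulo `y V`. -/
def epsTransvection (u : V) (t : F) : U h :=
  transvection h u (TrivSqZeroExt.inr t) (transvection_condition u t)

lemma epsTransvection_mem (u : V) (t : F) (v : V) : epsTransvection h u t ∈ C h v := by
  change (epsTransvection h u t).1 v - v ∈ yV F V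
  rw [epsTransvection, transvection_apply, add_sub_cancel_left]
  exact smul_mem_yV (by simp) _

/-- As `v` varies, only the square of its pairing with `u` matters; this is why the characters see
`v` only up to sign. -/
lemma beta_epsTransvection (lam : AddChar F ℂ) (h2 : (2 : F) ≠ 0) (u : V) (t : F) (v : V) :
    beta lam h v ⟨_, epsTransvection_mem u t v⟩ = lam (-(2 * t * residue h u v ^ 2)) := by
  change mu lam (h.form ((epsTransvection h u t).1 v) v) = _
  rw [mu_apply, epsTransvection, transvection_apply, map_add, LinearMap.add_apply,
    TrivSqZeroExt.snd_add, form_self_snd h2]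
  congr 1
  simp [residue]
  ring

/-- The characters `β_v` and `β_w` differ on the elements of `U` congruent to the identity
modulo `y V` unless `v ≡ ± w`. -/
theorem exists_beta_ne [Module.Free (DualNumber F) V] (hh : h.Nondegenerate) (h2 : (2 : F) ≠ 0)
    {lam : AddChar F ℂ} (hlam : lam.IsPrimitive) {v w : V} (h1 : w - v ∉ yV F V)
    (h3 : w + v ∉ yV F V) :
    ∃ (g : U h) (hv : g ∈ C h v) (hw : g ∈ C h w), beta lam h v ⟨g, hv⟩ ≠ beta lam h w ⟨g, hw⟩ := by
  obtain ⟨u, hu, hu'⟩ := exists_residue_ne_zero_and hh h1 h3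
  -- The difference of squares factors as the product of the pairings of `u` with `w - v` and `w +
  -- v`.
  have hd : 2 * (residue h u w ^ 2 - residue h u v ^ 2) ≠ 0 := by
    refine mul_ne_zero h2 ?_
    rw [residue_sub_right] at hu
    rw [residue_add_right] at hu'
    intro hc
    exact mul_ne_zero hu hu' (by linear_combination hc)
  obtain ⟨t, ht⟩ := AddChar.ne_one_iff.mp (hlam hd)
  refine ⟨epsTransvection h u t, epsTransvection_mem u t v, epsTransvection_mem u t w, ?_⟩
  rw [beta_epsTransvection lam h2, beta_epsTransvection lam h2]
  intro hc
  apply ht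
  rw [AddChar.mulShift_apply]
  have h4 : 2 * (residue h u w ^ 2 - residue h u v ^ 2) * t =
      -(2 * t * residue h u v ^ 2) + 2 * t * residue h u w ^ 2 := by ring
  rw [h4, AddChar.map_add_eq_mul, hc, ← AddChar.map_add_eq_mul, neg_add_cancel,
    AddChar.map_zero_eq_one]

/-- A norm-one scalar has constant term of square `1`, so it is `±1` modulo `y`. -/
lemma normOne_le (v : V) {g : U h} (hg : g ∈ normOne h) : g ∈ C h v ∨ iota h * g ∈ C h v := by
  obtain ⟨z, hz, hg⟩ := hg
  have hz1 : z.fst * z.fst = 1 := by simpa using congrArg TrivSqZeroExt.fst hz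
  rcases mul_self_eq_one_iff.mp hz1 with h1 | h1
  · left
    change g.1 v - v ∈ yV F V
    rw [hg]
    convert smul_mem_yV (a := z - 1) (by simp [h1]) v using 1
    rw [sub_smul, one_smul]
  · right
    change -(g.1 v) - v ∈ yV F V
    rw [hg]
    convert smul_mem_yV (a := -z - 1) (by simp [h1]) v using 1
    rw [sub_smul, one_smul, neg_smul]

lemma iota_mul_iota : iota h * iota h = 1 := by
  ext v
  simp [iota]

/-- `B(v)` is the union of the cosets `C(v)` and `ι C(v)`. -/
lemma mem_B_iff (v : V) {g : U h} : g ∈ B h v ↔ g ∈ C h v ∨ iota h * g ∈ C h v := by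
  constructor
  · let D : Subgroup (U h) :=
      { carrier := {g | g ∈ C h v ∨ iota h * g ∈ C h v}
        one_mem' := Or.inl (one_mem _)
        mul_mem' := by
          rintro a b (ha | ha) (hb | hb)
          · exact Or.inl (mul_mem ha hb)
          · refine Or.inr ?_
            have := mul_mem ha hb
            rwa [← mul_assoc, iota_comm, mul_assoc] at this
          · refine Or.inr ?_
            have := mul_mem ha hb
            rwa [mul_assoc] at this
          · refine Or.inl ?_
            have := mul_mem ha hb
            rwa [← iota_comm, mul_assoc, ← mul_assoc (iota h), iota_mul_iota, one_mul] at this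
        inv_mem' := by
          rintro a (ha | ha)
          · exact Or.inl (inv_mem ha)
          · refine Or.inr ?_
            have := inv_mem ha
            rwa [← iota_comm, mul_inv_rev, inv_eq_of_mul_eq_one_left iota_mul_iota] at this }
    have hD : B h v ≤ D := sup_le (fun g hg => Or.inl hg) (fun g hg => normOne_le v hg)
    exact fun hg => hD hg
  · rintro (hg | hg)
    · exact (le_sup_left : C h v ≤ B h v) hg
    · have := mul_mem (iota_mem_B h v) ((le_sup_left : C h v ≤ B h v) hg)
      rwa [← mul_assoc, iota_mul_iota, one_mul] at this

/-- That is, `v ≢ -v` modulo `yV`, so that `e_v` and `e_{-v}` have different supports. -/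
lemma not_sub_neg_mem (h2 : (2 : F) ≠ 0) {v : V} (hv : Primitive F v) : v + v ∉ yV F V := by
  intro hc
  have := (yV F V).smul_mem (TrivSqZeroExt.inl (2⁻¹ : F) : DualNumber F) hc
  rw [← two_smul (DualNumber F), smul_smul] at this
  have h3 : (TrivSqZeroExt.inl (2⁻¹ : F) : DualNumber F) * 2 = 1 := by
    have h4 : (2 : DualNumber F) = TrivSqZeroExt.inl 2 := rfl
    rw [h4, ← TrivSqZeroExt.inl_mul, inv_mul_cancel₀ h2, TrivSqZeroExt.inl_one]
  rw [h3, one_smul] at this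
  exact hv this

end Geometry

/-! ### Coordinates on the Weil module -/

section Coordinates

variable {F : Type*} [Field F] {V : Type*} [AddCommGroup V] [Module (DualNumber F) V]
  {lam : AddChar F ℂ} {h : HermitianForm F V}

open Classical in
variable (lam h) in
/-- The coordinate of a vector of the Weil module at `e_v`. -/
def coord (v : V) : X lam h →ₗ[ℂ] ℂ :=
  indLift (muExt lam h)
    -- If `x = k (0, v)⁻¹` with `k` in the inducing subgroup, the class of `x` is the value of the
    -- character at `k⁻¹` times `e_v`; otherwise it has no component there.
    (fun x => if hx : x * SemidirectProduct.inl (⟨0, v⟩ : Heisenberg h) ∈ AyVU h then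
      muExt lam h ⟨_, hx⟩⁻¹ else 0) fun k x => by
    by_cases hx : x * SemidirectProduct.inl (⟨0, v⟩ : Heisenberg h) ∈ AyVU h
    · have hkx : (k : HU h) * x * SemidirectProduct.inl (⟨0, v⟩ : Heisenberg h) ∈ AyVU h := by
        rw [mul_assoc]
        exact mul_mem k.2 hx
      have hk : (⟨_, hkx⟩ : AyVU h) = k * ⟨_, hx⟩ := Subtype.ext (mul_assoc _ _ _)
      rw [dif_pos hx, dif_pos hkx, hk, mul_inv_rev, map_mul, smul_eq_mul, mul_left_comm, ← map_mul,
        mul_inv_cancel, map_one, mul_one]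
    · have hkx : (k : HU h) * x * SemidirectProduct.inl (⟨0, v⟩ : Heisenberg h) ∉ AyVU h := by
        rw [mul_assoc]
        exact fun hc => hx ((Subgroup.mul_mem_cancel_left _ k.2).mp hc)
      rw [dif_neg hx, dif_neg hkx, smul_zero]

lemma coord_e_self (v : V) : coord lam h v (e lam h v) = 1 := by
  have hx : (SemidirectProduct.inl (⟨0, v⟩ : Heisenberg h) : HU h)⁻¹ *
      SemidirectProduct.inl (⟨0, v⟩ : Heisenberg h) = 1 := inv_mul_cancel _
  have hx' : (SemidirectProduct.inl (⟨0, v⟩ : Heisenberg h) : HU h)⁻¹ *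
      SemidirectProduct.inl (⟨0, v⟩ : Heisenberg h) ∈ AyVU h := hx ▸ one_mem _
  rw [e, coord, indLift_mk, one_smul, dif_pos hx']
  have h1 : (⟨_, hx'⟩ : AyVU h) = 1 := Subtype.ext hx
  rw [h1, inv_one, map_one]

lemma coord_e_of_not_mem {v w : V} (hvw : w - v ∉ yV F V) : coord lam h v (e lam h w) = 0 := by
  rw [e, coord, indLift_mk, one_smul, dif_neg]
  rw [← map_inv, ← map_mul]
  intro hc
  apply hvw
  have h1 : -w + v ∈ yV F V := hc
  have h2 := neg_mem h1
  rwa [neg_add, neg_neg, ← sub_eq_add_neg] at h2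

lemma e_ne_zero (v : V) : e lam h v ≠ 0 := by
  intro hc
  have h1 := coord_e_self (lam := lam) (h := h) v
  rw [hc, map_zero] at h1
  exact zero_ne_one h1

/-- The `e_v` span: every `x` lies in the coset of `(0, v)⁻¹`, where `v` is the `V`-component of
`x⁻¹`. -/
lemma hom_ext_e {W : Type*} [AddCommGroup W] [Module ℂ W] {f g : X lam h →ₗ[ℂ] W}
    (hfg : ∀ v, f (e lam h v) = g (e lam h v)) : f = g := by
  refine Representation.IndV.hom_ext _ _ fun x => LinearMap.ext_ring ?_
  change f (Representation.IndV.mk (AyVU h).subtype (linRep (muExt lam h)) x 1) =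
    g (Representation.IndV.mk (AyVU h).subtype (linRep (muExt lam h)) x 1)
  let v : V := (x⁻¹).left.snd
  have hk : x * SemidirectProduct.inl (⟨0, v⟩ : Heisenberg h) ∈ AyVU h := by
    rw [← inv_mem_iff, mul_inv_rev, ← map_inv]
    change -v + (1 : U h).1 v ∈ yV F V
    simp
  have h1 := smul_indMk_mul (muExt lam h) (⟨_, hk⟩ : AyVU h)
    (SemidirectProduct.inl (⟨0, v⟩ : Heisenberg h))⁻¹
  have h3 : Representation.IndV.mk (AyVU h).subtype (linRep (muExt lam h)) x 1 =
      muExt lam h (⟨_, hk⟩⁻¹ : AyVU h) • e lam h v := by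
    rw [e, ← h1, smul_smul, ← map_mul (muExt lam h), inv_mul_cancel,
      map_one (muExt lam h), one_smul]
    change _ = Representation.IndV.mk (AyVU h).subtype (linRep (muExt lam h))
      (x * SemidirectProduct.inl (⟨0, v⟩ : Heisenberg h) *
        (SemidirectProduct.inl (⟨0, v⟩ : Heisenberg h))⁻¹) 1
    rw [mul_inv_cancel_right]
  rw [h3, map_smul, map_smul, hfg]

lemma mu_ne_zero (a : DualNumber F) : mu lam a ≠ 0 := by
  intro h0
  have h1 : mu lam (a + -a) = 0 := by rw [AddChar.map_add_eq_mul, h0, zero_mul]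
  rw [add_neg_cancel, AddChar.map_zero_eq_one] at h1
  exact one_ne_zero h1

lemma mu_conj (a : DualNumber F) : mu lam (conj F a) = mu lam (-a) := by
  simp [mu_apply]

/-- If `w ≡ v` modulo `y V` then `e_w` is a multiple of `e_v`. -/
lemma exists_e_eq_smul {v w : V} (hvw : w - v ∈ yV F V) :
    ∃ c : ℂ, c ≠ 0 ∧ e lam h w = c • e lam h v :=
  ⟨_, mu_ne_zero _, by rw [← e_add lam h v (w - v) hvw, add_sub_cancel]⟩

lemma weil_e_of_mem {v : V} (g : C h v) : weil lam h g (e lam h v) = beta lam h v g • e lam h v := by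
  have h1 := e_add lam h v _ g.2
  rw [add_sub_cancel] at h1
  rw [weil_e, h1]
  congr 1
  change _ = mu lam (h.form (g.1.1 v) v)
  rw [h.symm v, mu_conj, map_sub, neg_sub, sub_eq_add_neg, AddChar.map_add_eq_mul, mu_form_self,
    one_mul]

lemma weil_iota_e (v : V) : weil lam h (iota h) (e lam h v) = e lam h (-v) :=
  weil_e lam h (iota h) v

lemma weil_iota_comm (g : U h) (x : X lam h) :
    weil lam h g (weil lam h (iota h) x) = weil lam h (iota h) (weil lam h g x) := by
  rw [← Module.End.mul_apply, ← map_mul, iota_comm, map_mul, Module.End.mul_apply]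

lemma weil_e_neg_of_mem {v : V} (g : C h v) :
    weil lam h g (e lam h (-v)) = beta lam h v g • e lam h (-v) := by
  rw [← weil_iota_e, weil_iota_comm, weil_e_of_mem, map_smul]

/-- An element of `C(v)` permutes the classes modulo `yV` and fixes that of `v`, so no other
coordinate contributes. -/
lemma coord_weil {v : V} (g : C h v) (x : X lam h) :
    coord lam h v (weil lam h g x) = beta lam h v g * coord lam h v x := by
  refine LinearMap.congr_fun (f := coord lam h v ∘ₗ weil lam h g)
    (g := beta lam h v g • coord lam h v) (hom_ext_e fun w => ?_) x
  rw [LinearMap.comp_apply, LinearMap.smul_apply]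
  by_cases hvw : w - v ∈ yV F V
  · obtain ⟨c, -, hc⟩ := exists_e_eq_smul (lam := lam) (h := h) hvw
    rw [hc, map_smul, weil_e_of_mem, map_smul, map_smul, map_smul, smul_comm]
  · rw [coord_e_of_not_mem hvw, weil_e, coord_e_of_not_mem, smul_zero]
    intro hc
    apply hvw
    have h1 : g.1.1 w - g.1.1 v ∈ yV F V := by
      have := sub_mem hc g.2
      rwa [sub_sub_sub_cancel_right] at this
    rw [← map_sub] at h1
    simpa [← LinearEquiv.mul_apply] using apply_mem_yV (g.1⁻¹).1 h1

/-- The scalar relating `e_w` to `e_v` cancels against the inverse one relating the coordinates: the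
component depends only on the class. -/
lemma coord_smul_e_congr {v w : V} (hvw : w - v ∈ yV F V) (x : X lam h) :
    coord lam h w x • e lam h w = coord lam h v x • e lam h v := by
  obtain ⟨c, hc0, hc⟩ := exists_e_eq_smul (lam := lam) (h := h) hvw
  have h1 : coord lam h v = c • coord lam h w := hom_ext_e fun z => by
    rw [LinearMap.smul_apply]
    by_cases hz : z - v ∈ yV F V
    · have hzw : z - w ∈ yV F V := by simpa using sub_mem hz hvw
      obtain ⟨d, hd0, hd⟩ := exists_e_eq_smul (lam := lam) (h := h) hzw
      rw [hd, map_smul, map_smul, coord_e_self, hc, map_smul, coord_e_self, smul_comm]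
    · rw [coord_e_of_not_mem hz, coord_e_of_not_mem, smul_zero]
      exact fun hzw => hz (by simpa using add_mem hzw hvw)
  rw [h1, hc, LinearMap.smul_apply, smul_smul, smul_eq_mul, mul_comm]

/-- Summing over all of `V` counts each class `|yV|` times, which avoids choosing a transversal. -/
lemma card_smul_eq_sum [Fintype V] (x : X lam h) :
    (Nat.card (yV F V) : ℂ) • x = ∑ v : V, coord lam h v x • e lam h v := by
  classical
  have h1 : (Nat.card (yV F V) : ℂ) • LinearMap.id =
      ∑ v : V, (coord lam h v).smulRight (e lam h v) := hom_ext_e fun w => by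
    rw [LinearMap.sum_apply]
    simp only [LinearMap.smul_apply, LinearMap.id_apply, LinearMap.smulRight_apply]
    rw [← Equiv.sum_comp (Equiv.addLeft w)]
    have h2 : ∀ u : V, coord lam h (Equiv.addLeft w u) (e lam h w) • e lam h (Equiv.addLeft w u) =
        if u ∈ yV F V then e lam h w else 0 := by
      intro u
      rw [Equiv.coe_addLeft]
      split_ifs with hu
      · rw [coord_smul_e_congr (v := w) (by simpa using hu), coord_e_self, one_smul]
      · rw [coord_e_of_not_mem (by simpa using hu), zero_smul]
    rw [Finset.sum_congr rfl fun u _ => h2 u, ← Finset.sum_filter, Finset.sum_const,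
      ← Nat.cast_smul_eq_nsmul ℂ, Nat.card_eq_fintype_card, ← Fintype.card_subtype]
  have h2 := LinearMap.congr_fun h1 x
  rw [LinearMap.sum_apply] at h2
  exact h2

variable [Finite V]

lemma card_yV_ne_zero : (Nat.card (yV F V) : ℂ) ≠ 0 :=
  Nat.cast_ne_zero.mpr Nat.card_pos.ne'

lemma eq_zero_of_coord {x : X lam h} (hx : ∀ v, coord lam h v x = 0) : x = 0 := by
  have := Fintype.ofFinite V
  have h1 := card_smul_eq_sum x
  rw [Finset.sum_eq_zero fun v _ => by rw [hx, zero_smul]] at h1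
  exact (smul_eq_zero.mp h1).resolve_left card_yV_ne_zero

lemma mem_of_coord {x : X lam h} {P : Submodule ℂ (X lam h)}
    (hx : ∀ v, coord lam h v x ≠ 0 → e lam h v ∈ P) : x ∈ P := by
  have := Fintype.ofFinite V
  have h1 : (Nat.card (yV F V) : ℂ) • x ∈ P := by
    rw [card_smul_eq_sum]
    refine sum_mem fun v _ => ?_
    by_cases h0 : coord lam h v x = 0
    · rw [h0, zero_smul]
      exact zero_mem P
    · exact P.smul_mem _ (hx v h0)
  exact (Submodule.smul_mem_iff P card_yV_ne_zero).mp h1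

/-- The vectors of `X` on which `C(v)` acts through `β_v` are the combinations of `e_v` and
`e_{-v}`. -/
theorem mem_span_pair_of_weil_eq [Module.Free (DualNumber F) V] (hh : h.Nondegenerate)
    (h2 : (2 : F) ≠ 0) (hlam : lam.IsPrimitive) {v : V} {x : X lam h}
    (hx : ∀ g : C h v, weil lam h g x = beta lam h v g • x) :
    x ∈ Submodule.span ℂ {e lam h v, e lam h (-v)} := by
  refine mem_of_coord fun w hw => ?_
  have hv : e lam h v ∈ Submodule.span ℂ {e lam h v, e lam h (-v)} :=
    Submodule.subset_span (Or.inl rfl)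
  have hv' : e lam h (-v) ∈ Submodule.span ℂ {e lam h v, e lam h (-v)} :=
    Submodule.subset_span (Or.inr rfl)
  by_cases h1 : w - v ∈ yV F V
  · obtain ⟨c, -, hc⟩ := exists_e_eq_smul (lam := lam) (h := h) h1
    rw [hc]
    exact Submodule.smul_mem _ _ hv
  by_cases h3 : w + v ∈ yV F V
  · obtain ⟨c, -, hc⟩ := exists_e_eq_smul (lam := lam) (h := h) (v := -v) (w := w) (by simpa using h3)
    rw [hc]
    exact Submodule.smul_mem _ _ hv'
  -- Such a `g` would multiply the nonzero coordinate at `w` by two different scalars.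
  obtain ⟨g, hgv, hgw, hne⟩ := exists_beta_ne hh h2 hlam h1 h3
  refine absurd ?_ hne
  have h4 := coord_weil (lam := lam) ⟨g, hgw⟩ x
  rw [hx ⟨g, hgv⟩, map_smul, smul_eq_mul] at h4
  exact mul_right_cancel₀ hw h4

instance : Finite (U h) :=
  Finite.of_injective (fun g : U h => (g.1 : V → V)) fun _ _ hab =>
    Subtype.ext (DFunLike.coe_injective hab)

/-- Every subrepresentation on which the coordinate at `v` does not vanish contains a vector
on which `C(v)` acts through `β_v`, with nonzero coordinate at `v`. -/
lemma exists_weil_eq {P : Subrepresentation (weil lam h)} {x : X lam h} (hx : x ∈ P.toSubmodule)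
    {v : V} (hv : coord lam h v x ≠ 0) :
    ∃ z ∈ P.toSubmodule, coord lam h v z ≠ 0 ∧
      ∀ g : C h v, weil lam h g z = beta lam h v g • z := by
  have := Fintype.ofFinite (C h v)
  have hb : ∀ g : C h v, beta lam h v g⁻¹ * beta lam h v g = 1 := fun g => by
    rw [← map_mul, inv_mul_cancel, map_one]
  refine ⟨∑ g : C h v, beta lam h v g⁻¹ • weil lam h g x,
    sum_mem fun g _ => P.toSubmodule.smul_mem _ (P.apply_mem_toSubmodule _ hx), ?_,
    map_sum_isotypic (beta lam h v) (weil lam h) x⟩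
  -- The twist cancels the factor from the action, so all summands have the same coordinate at `v`
  -- and nothing cancels.
  have h1 : ∀ g : C h v, coord lam h v (beta lam h v g⁻¹ • weil lam h g x) =
      coord lam h v x := fun g => by
    rw [(coord lam h v).map_smul, coord_weil, smul_eq_mul, ← mul_assoc, hb, one_mul]
  rw [map_sum, Finset.sum_congr rfl fun g _ => h1 g, Finset.sum_const, nsmul_eq_mul]
  exact mul_ne_zero (Nat.cast_ne_zero.mpr (Finset.card_ne_zero.mpr Finset.univ_nonempty)) hv

end Coordinates

/-! ### Irreducible constituents of the Weil module -/

section Constituents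

variable {F : Type*} [Field F] {V : Type*} [AddCommGroup V] [Module (DualNumber F) V]
  {lam : AddChar F ℂ} {h : HermitianForm F V}

variable (lam h) in
/-- The vector `e_v + ε e_{-v}`. -/
def eSign (ε : ℤˣ) (v : V) : X lam h := e lam h v + ((ε : ℤ) : ℂ) • e lam h (-v)

lemma weil_eSign (ε : ℤˣ) (g : U h) (v : V) :
    weil lam h g (eSign lam h ε v) = eSign lam h ε (g.1 v) := by
  rw [eSign, eSign, map_add, map_smul, weil_e, weil_e, map_neg]

lemma weil_iota_weil_iota (x : X lam h) : weil lam h (iota h) (weil lam h (iota h) x) = x := by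
  rw [← Module.End.mul_apply, ← map_mul, iota_mul_iota, map_one, Module.End.one_apply]

lemma weil_iota_eSign (ε : ℤˣ) (v : V) :
    weil lam h (iota h) (eSign lam h ε v) = ((ε : ℤ) : ℂ) • eSign lam h ε v := by
  rw [eSign, map_add, map_smul, ← weil_iota_e v, weil_iota_weil_iota]
  exact smul_add_smul_of_mul_self (sign_mul_self ε) _ _

lemma weil_eSign_of_mem (ε : ℤˣ) {v : V} (g : C h v) :
    weil lam h g (eSign lam h ε v) = beta lam h v g • eSign lam h ε v := by
  rw [eSign, map_add, map_smul, weil_e_of_mem, weil_e_neg_of_mem, smul_add, smul_comm]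

/-- The same scalar serves for `w` and `-w`, because `e_{-w} = ι e_w`. -/
lemma exists_eSign_eq_smul (ε : ℤˣ) {v w : V} (hvw : w - v ∈ yV F V) :
    ∃ c : ℂ, c ≠ 0 ∧ eSign lam h ε w = c • eSign lam h ε v := by
  obtain ⟨c, hc0, hc⟩ := exists_e_eq_smul (lam := lam) (h := h) hvw
  refine ⟨c, hc0, ?_⟩
  rw [eSign, eSign, ← weil_iota_e w, ← weil_iota_e v, hc, map_smul, smul_add, smul_comm]

lemma coord_eSign_self (h2 : (2 : F) ≠ 0) (ε : ℤˣ) {v : V} (hv : Primitive F v) :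
    coord lam h v (eSign lam h ε v) = 1 := by
  have h1 : -v - v ∉ yV F V := fun hc => not_sub_neg_mem h2 hv (by
    have := neg_mem hc
    rwa [neg_sub, sub_neg_eq_add] at this)
  rw [eSign, map_add, map_smul, coord_e_self, coord_e_of_not_mem h1, smul_zero, add_zero]

lemma eSign_ne_zero (h2 : (2 : F) ≠ 0) (ε : ℤˣ) {v : V} (hv : Primitive F v) :
    eSign lam h ε v ≠ 0 := by
  intro hc
  have h1 := coord_eSign_self (lam := lam) (h := h) h2 ε hv
  rw [hc, map_zero] at h1
  exact zero_ne_one h1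

lemma coord_weil_eSign_of_not_mem_B (ε : ℤˣ) {v w : V} {g : U h} (h1 : g.1 w - v ∉ yV F V)
    (h3 : (iota h * g).1 w - v ∉ yV F V) :
    coord lam h v (weil lam h g (eSign lam h ε w)) = 0 := by
  have h4 : -g.1 w - v ∉ yV F V := h3
  rw [weil_eSign, eSign, map_add, map_smul, coord_e_of_not_mem h1, coord_e_of_not_mem h4,
    smul_zero, add_zero]

/-- The generators are supported at the classes of `g v` and `ι g v`, all in the `∼`-class of `v`.
This support argument separates the summands. -/
lemma coord_eq_zero_of_mem_topSignAt {ε : ℤˣ} {v w : V} {x : X lam h}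
    (hx : x ∈ (topSignAt lam h ε v).toSubmodule) (hvw : ¬ Rel h v w) : coord lam h w x = 0 := by
  have h1 : (topSignAt lam h ε v).toSubmodule ≤ LinearMap.ker (coord lam h w) := by
    refine Submodule.span_le.mpr ?_
    rintro _ ⟨g, rfl⟩
    exact coord_weil_eSign_of_not_mem_B ε (fun hc => hvw ⟨g, hc⟩)
      (fun hc => hvw ⟨iota h * g, hc⟩)
  exact h1 hx

lemma weil_iota_of_mem_topSignAt {ε : ℤˣ} {v : V} {x : X lam h}
    (hx : x ∈ (topSignAt lam h ε v).toSubmodule) :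
    weil lam h (iota h) x = ((ε : ℤ) : ℂ) • x := by
  have h1 : (topSignAt lam h ε v).toSubmodule ≤
      Module.End.eigenspace (weil lam h (iota h)) ((ε : ℤ) : ℂ) := by
    refine Submodule.span_le.mpr ?_
    rintro _ ⟨g, rfl⟩
    refine Module.End.mem_eigenspace_iff.mpr ?_
    change weil lam h (iota h) (weil lam h g (eSign lam h ε v)) =
      ((ε : ℤ) : ℂ) • weil lam h g (eSign lam h ε v)
    rw [weil_eSign, weil_iota_eSign]
  exact Module.End.mem_eigenspace_iff.mp (h1 hx)

lemma eSign_mem_topSignAt (ε : ℤˣ) (v : V) :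
    eSign lam h ε v ∈ (topSignAt lam h ε v).toSubmodule :=
  mem_generated_self _ _

lemma topSignAt_le {ε : ℤˣ} {v : V} {P : Subrepresentation (weil lam h)}
    (hv : eSign lam h ε v ∈ P.toSubmodule) :
    (topSignAt lam h ε v).toSubmodule ≤ P.toSubmodule :=
  generated_le _ hv

lemma Rel.symm {v w : V} (hvw : Rel h v w) : Rel h w v := by
  obtain ⟨g, hg⟩ := hvw
  refine ⟨g⁻¹, ?_⟩
  have h1 := neg_mem (apply_mem_yV (g⁻¹).1 hg)
  have h3 : (g⁻¹).1 (g.1 v) = v := by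
    rw [← LinearEquiv.mul_apply]
    simp
  rwa [map_sub, h3, neg_sub] at h1

lemma eSign_mem_topSignAt_of_rel (ε : ℤˣ) {v w : V} (hvw : Rel h v w) :
    eSign lam h ε w ∈ (topSignAt lam h ε v).toSubmodule := by
  obtain ⟨g, hg⟩ := hvw
  obtain ⟨c, -, hc⟩ := exists_eSign_eq_smul (lam := lam) (h := h) ε
    (v := g.1 v) (w := w) (by simpa using neg_mem hg)
  rw [hc, ← weil_eSign]
  exact Submodule.smul_mem _ _ (Subrepresentation.apply_mem_toSubmodule _ g
    (eSign_mem_topSignAt ε v))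

lemma topSignAt_congr (ε : ℤˣ) {v w : V} (hvw : Rel h v w) :
    topSignAt lam h ε v = topSignAt lam h ε w :=
  Subrepresentation.toSubmodule_injective <|
    le_antisymm (topSignAt_le (eSign_mem_topSignAt_of_rel ε hvw.symm))
      (topSignAt_le (eSign_mem_topSignAt_of_rel ε hvw))

lemma sign_injective : Function.Injective fun ε : ℤˣ => ((ε : ℤ) : ℂ) :=
  fun _ _ hab => Units.ext (Int.cast_injective hab)

/-- The eigenvalue of `ι` gives the sign, the support gives the class. -/
lemma eq_and_rel_of_eSign_mem (h2 : (2 : F) ≠ 0) {ε ε' : ℤˣ} {v w : V} (hw : Primitive F w)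
    (hmem : eSign lam h ε' w ∈ (topSignAt lam h ε v).toSubmodule) : ε' = ε ∧ Rel h v w := by
  constructor
  · have h1 := weil_iota_of_mem_topSignAt hmem
    rw [weil_iota_eSign] at h1
    exact sign_injective (smul_left_injective ℂ (eSign_ne_zero h2 ε' hw) h1)
  · by_contra hc
    have h1 := coord_eq_zero_of_mem_topSignAt hmem hc
    rw [coord_eSign_self h2 ε' hw] at h1
    exact one_ne_zero h1

lemma bot_toSubmodule : (bot lam h).toSubmodule = Submodule.span ℂ {e lam h 0} := by
  apply le_antisymm
  · refine Submodule.span_le.mpr ?_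
    rintro _ ⟨v, hv, rfl⟩
    obtain ⟨c, -, hc⟩ := exists_e_eq_smul (lam := lam) (h := h) (v := 0) (w := v)
      (by simpa using not_not.mp hv)
    rw [hc]
    exact Submodule.smul_mem _ _ (Submodule.mem_span_singleton_self _)
  · refine Submodule.span_mono ?_
    rintro _ rfl
    exact ⟨0, not_not_intro (zero_mem _), rfl⟩

lemma e_zero_mem_bot : e lam h 0 ∈ (bot lam h).toSubmodule := by
  rw [bot_toSubmodule]
  exact Submodule.mem_span_singleton_self _

lemma not_rel_zero {v : V} (hv : Primitive F v) : ¬ Rel h v 0 := by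
  rintro ⟨g, hg⟩
  rw [sub_zero] at hg
  exact hv.apply g hg

lemma bot_not_le_topSignAt (ε : ℤˣ) {v : V} (hv : Primitive F v) :
    ¬ (bot lam h).toSubmodule ≤ (topSignAt lam h ε v).toSubmodule := by
  intro hc
  have h1 := coord_eq_zero_of_mem_topSignAt (hc e_zero_mem_bot) (not_rel_zero hv)
  rw [coord_e_self] at h1
  exact one_ne_zero h1

lemma isIrreducible_bot : (bot lam h).toRepresentation.IsIrreducible := by
  rw [isIrreducible_iff, bot_toSubmodule]
  refine ⟨fun hc => e_ne_zero 0 (Submodule.span_singleton_eq_bot.mp hc), fun Q hQ hQ0 => ?_⟩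
  obtain ⟨z, hz, hz0⟩ := Submodule.exists_mem_ne_zero_of_ne_bot hQ0
  refine le_antisymm hQ ?_
  obtain ⟨c, rfl⟩ := Submodule.mem_span_singleton.mp (hQ hz)
  rw [Submodule.span_singleton_le_iff_mem]
  exact (Submodule.smul_mem_iff _ (smul_ne_zero_iff.mp hz0).1).mp hz

/-- `Bot` affords the trivial representation. -/
lemma nonempty_bot_equiv_trivial :
    Nonempty ((bot lam h).toRepresentation.Equiv (Representation.trivial ℂ (U h) ℂ)) := by
  let L : ℂ →ₗ[ℂ] (bot lam h).toSubmodule :=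
    LinearMap.toSpanSingleton ℂ _ ⟨e lam h 0, e_zero_mem_bot⟩
  have hL : ∀ c : ℂ, ((L c : (bot lam h).toSubmodule) : X lam h) = c • e lam h 0 := fun _ => rfl
  have hbij : Function.Bijective L := by
    constructor
    · intro a b hab
      have h1 := congrArg Subtype.val hab
      rw [hL, hL] at h1
      exact smul_left_injective ℂ (e_ne_zero 0) h1
    · rintro ⟨z, hz⟩
      have hz' := hz
      rw [bot_toSubmodule] at hz'
      obtain ⟨c, rfl⟩ := Submodule.mem_span_singleton.mp hz'
      exact ⟨c, Subtype.ext (hL c)⟩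
  refine ⟨Representation.Equiv.symm (Representation.Equiv.mk (LinearEquiv.ofBijective L hbij)
    fun g => LinearMap.ext fun c => Subtype.ext ?_)⟩
  change c • e lam h 0 = weil lam h g (c • e lam h 0)
  rw [map_smul, weil_e, map_zero]

variable [Finite V] [Module.Free (DualNumber F) V]

/-- The action of `C(v)` confines `x` to the span of `e_v` and `e_{-v}`; `ι` swaps these two, and
its eigenvalue picks the line. -/
lemma mem_span_eSign (hh : h.Nondegenerate) (h2 : (2 : F) ≠ 0) (hlam : lam.IsPrimitive) {ε : ℤˣ}
    {v : V} {x : X lam h} (hx : ∀ g : C h v, weil lam h g x = beta lam h v g • x)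
    (hι : weil lam h (iota h) x = ((ε : ℤ) : ℂ) • x) :
    x ∈ Submodule.span ℂ {eSign lam h ε v} := by
  obtain ⟨a, b, hab⟩ := Submodule.mem_span_pair.mp (mem_span_pair_of_weil_eq hh h2 hlam hx)
  have h1 : b • e lam h v + a • e lam h (-v) = ((ε : ℤ) : ℂ) • x := by
    rw [← hι, ← hab, map_add, map_smul, map_smul, weil_iota_e, weil_iota_e, neg_neg, add_comm]
  exact Submodule.mem_span_singleton.mpr ⟨_, eq_smul_of_involution (sign_mul_self ε) hab h1⟩

/-- Every nonzero subrepresentation contains a nonzero vector `e_v ± e_{-v}`. -/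
theorem exists_eSign_mem (hh : h.Nondegenerate) (h2 : (2 : F) ≠ 0) (hlam : lam.IsPrimitive)
    {P : Subrepresentation (weil lam h)} (hP : P.toSubmodule ≠ ⊥) :
    ∃ ε v, eSign lam h ε v ≠ 0 ∧ eSign lam h ε v ∈ P.toSubmodule := by
  obtain ⟨x, hx, hx0⟩ := Submodule.exists_mem_ne_zero_of_ne_bot hP
  obtain ⟨v, hv⟩ : ∃ v, coord lam h v x ≠ 0 := by
    by_contra! hc
    exact hx0 (eq_zero_of_coord hc)
  obtain ⟨z, hz, hz0, hzv⟩ := exists_weil_eq hx hv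
  have hz0' : z ≠ 0 := fun hc => hz0 (by rw [hc, map_zero])
  obtain ⟨ε, w, hw, hw0, hwv, hι⟩ :=
    exists_sign_eigenvector (beta lam h v) (weil lam h) iota_mul_iota (iota_comm h) hz hz0' hzv
  obtain ⟨c, rfl⟩ := Submodule.mem_span_singleton.mp (mem_span_eSign hh h2 hlam hwv hι)
  exact ⟨ε, v, (smul_ne_zero_iff.mp hw0).2,
    (Submodule.smul_mem_iff _ (smul_ne_zero_iff.mp hw0).1).mp hw⟩

/-- For non-primitive `v` the vector found in `P` is a nonzero multiple of `e_0`, which spans `Bot`.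
-/
lemma bot_le_or_exists (hh : h.Nondegenerate) (h2 : (2 : F) ≠ 0) (hlam : lam.IsPrimitive)
    {P : Subrepresentation (weil lam h)} (hP : P.toSubmodule ≠ ⊥) :
    (bot lam h).toSubmodule ≤ P.toSubmodule ∨
      ∃ ε v, Primitive F v ∧ eSign lam h ε v ∈ P.toSubmodule := by
  obtain ⟨ε, v, h0, hv⟩ := exists_eSign_mem hh h2 hlam hP
  by_cases hprim : Primitive F v
  · exact Or.inr ⟨ε, v, hprim, hv⟩
  · left
    obtain ⟨c, -, hc⟩ := exists_e_eq_smul (lam := lam) (h := h) (v := 0) (w := v)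
      (by simpa using not_not.mp hprim)
    have h1 : eSign lam h ε v = (c + ((ε : ℤ) : ℂ) * c) • e lam h 0 := by
      rw [eSign, ← weil_iota_e v, hc, map_smul, weil_iota_e, neg_zero, smul_smul, add_smul]
    rw [h1] at h0 hv
    rw [bot_toSubmodule, Submodule.span_singleton_le_iff_mem]
    exact (Submodule.smul_mem_iff _ (smul_ne_zero_iff.mp h0).1).mp hv

/-- A nonzero submodule contains some `e_w ± e_{-w}` or `Bot`. Support excludes `Bot` and, with `ι`,
forces the right sign and `w ∼ v`, so the submodule contains a generator. -/
theorem isIrreducible_topSignAt (hh : h.Nondegenerate) (h2 : (2 : F) ≠ 0)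
    (hlam : lam.IsPrimitive) (ε : ℤˣ) {v : V} (hv : Primitive F v) :
    (topSignAt lam h ε v).toRepresentation.IsIrreducible := by
  refine (isIrreducible_iff _ _).mpr ⟨fun hc => ?_, fun Q hQ hQ0 => ?_⟩
  · have h1 := eSign_mem_topSignAt (lam := lam) (h := h) ε v
    rw [hc] at h1
    exact eSign_ne_zero h2 ε hv ((Submodule.mem_bot ℂ).mp h1)
  · rcases bot_le_or_exists hh h2 hlam hQ0 with h1 | ⟨ε', w, hw, hmem⟩
    · exact absurd (h1.trans hQ) (bot_not_le_topSignAt ε hv)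
    · obtain ⟨rfl, hvw⟩ := eq_and_rel_of_eSign_mem h2 hw (hQ hmem)
      refine le_antisymm hQ ?_
      rw [topSignAt_congr _ hvw]
      exact topSignAt_le hmem

/-- The list of the irreducible subrepresentations of the Weil module. -/
theorem isIrreducible_iff_eq (hh : h.Nondegenerate) (h2 : (2 : F) ≠ 0) (hlam : lam.IsPrimitive)
    (P : Subrepresentation (weil lam h)) :
    P.toRepresentation.IsIrreducible ↔
      P = bot lam h ∨ ∃ ε v, Primitive F v ∧ P = topSignAt lam h ε v := by
  constructor
  · intro hP
    obtain ⟨h0, hmin⟩ := (isIrreducible_iff _ _).mp hP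
    rcases bot_le_or_exists hh h2 hlam h0 with h1 | ⟨ε, w, hw, hmem⟩
    · exact Or.inl (Subrepresentation.toSubmodule_injective
        (hmin _ h1 ((isIrreducible_iff _ _).mp isIrreducible_bot).1).symm)
    · exact Or.inr ⟨ε, w, hw, Subrepresentation.toSubmodule_injective
        (hmin _ (topSignAt_le hmem)
          ((isIrreducible_iff _ _).mp (isIrreducible_topSignAt hh h2 hlam ε hw)).1).symm⟩
  · rintro (rfl | ⟨ε, v, hv, rfl⟩)
    · exact isIrreducible_bot
    · exact isIrreducible_topSignAt hh h2 hlam ε hv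

theorem isMultiplicityFree_weil (hh : h.Nondegenerate) (h2 : (2 : F) ≠ 0)
    (hlam : lam.IsPrimitive) : IsMultiplicityFree (weil lam h) := by
  refine isMultiplicityFree_of_eigenlines _ fun P hP => ?_
  obtain ⟨ε, v, hf0, hf⟩ := exists_eSign_mem hh h2 hlam hP
  refine ⟨_, hf, hf0, insert (iota h, ((ε : ℤ) : ℂ))
    (Set.range fun g : C h v => ((g : U h), beta lam h v g)), ?_, fun x hx => ?_⟩
  · rintro t (rfl | ⟨g, rfl⟩)
    · exact weil_iota_eSign ε v
    · exact weil_eSign_of_mem ε g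
  · have hx1 := hx (iota h, ((ε : ℤ) : ℂ)) (Set.mem_insert _ _)
    have hx2 : ∀ g : C h v, weil lam h g x = beta lam h v g • x := fun g =>
      hx (g, beta lam h v g) (Set.mem_insert_of_mem _ (Set.mem_range_self g))
    exact mem_span_eSign hh h2 hlam hx2 hx1

end Constituents

/-! ### Direct sums, extensions of `β_v`, and counting constituents -/

section Decomposition

variable {F : Type*} [Field F] {V : Type*} [AddCommGroup V] [Module (DualNumber F) V]
  {lam : AddChar F ℂ} {h : HermitianForm F V}

lemma Rel.refl (v : V) : Rel h v v := ⟨1, by simp⟩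

lemma Rel.trans {u v w : V} (huv : Rel h u v) (hvw : Rel h v w) : Rel h u w := by
  obtain ⟨a, ha⟩ := huv
  obtain ⟨b, hb⟩ := hvw
  refine ⟨b * a, ?_⟩
  have h1 := add_mem (apply_mem_yV b.1 ha) hb
  rw [map_sub, sub_add_sub_cancel] at h1
  exact h1

lemma IsRepresentativeSet.eq_of_rel {S : Set V} (hS : IsRepresentativeSet h S) {s t : V}
    (hs : s ∈ S) (ht : t ∈ S) (hst : Rel h s t) : s = t :=
  (hS.2 s (hS.1 s hs)).unique ⟨hs, Rel.refl s⟩ ⟨ht, hst⟩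

/-- The supports of the summands are disjoint, so a common vector has all coordinates zero. -/
lemma iSupIndep_topSignAt [Finite V] {S : Set V} (hS : IsRepresentativeSet h S) (ε : ℤˣ) :
    iSupIndep (fun s : S => (topSignAt lam h ε s).toSubmodule) := by
  refine iSupIndep_def.mpr fun s => Submodule.disjoint_def.mpr fun x hx hx' =>
    eq_zero_of_coord fun w => ?_
  by_cases hsw : Rel h s w
  · have h1 : ⨆ (j : S) (_ : j ≠ s), (topSignAt lam h ε (j : V)).toSubmodule ≤
        LinearMap.ker (coord lam h w) := by
      refine iSup₂_le fun j hj y hy => coord_eq_zero_of_mem_topSignAt hy fun hjw => hj ?_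
      exact Subtype.ext (hS.eq_of_rel j.2 s.2 (hjw.trans hsw.symm))
    exact h1 hx'
  · exact coord_eq_zero_of_mem_topSignAt hx hsw

lemma eSign_mem_topSign (ε : ℤˣ) {v : V} (hv : Primitive F v) :
    eSign lam h ε v ∈ (topSign lam h ε).toSubmodule :=
  ⟨add_mem (Submodule.subset_span ⟨v, hv, rfl⟩)
    (Submodule.smul_mem _ _ (Submodule.subset_span ⟨-v, hv.neg, rfl⟩)),
    Module.End.mem_eigenspace_iff.mpr (weil_iota_eSign ε v)⟩

lemma iSup_topSignAt {S : Set V} (hS : IsRepresentativeSet h S) (ε : ℤˣ) :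
    ⨆ s : S, (topSignAt lam h ε s).toSubmodule = (topSign lam h ε).toSubmodule := by
  apply le_antisymm
  · exact iSup_le fun s => topSignAt_le (eSign_mem_topSign ε (hS.1 s s.2))
  · intro x hx
    -- The operator `1 + ε ι` sends `e_v` to `e_v + ε e_{-v}` and doubles the vectors of the
    -- `ε`-eigenspace.
    have h1 : (top lam h).toSubmodule ≤ (⨆ s : S, (topSignAt lam h ε s).toSubmodule).comap
        (LinearMap.id + ((ε : ℤ) : ℂ) • weil lam h (iota h)) := by
      refine Submodule.span_le.mpr ?_
      rintro _ ⟨v, hv, rfl⟩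
      obtain ⟨s, ⟨hs, hvs⟩, -⟩ := hS.2 v hv
      have h3 : eSign lam h ε v ∈ ⨆ s : S, (topSignAt lam h ε s).toSubmodule :=
        Submodule.mem_iSup_of_mem ⟨s, hs⟩ (eSign_mem_topSignAt_of_rel ε hvs.symm)
      rw [eSign, ← weil_iota_e] at h3
      exact h3
    exact mem_of_add_smul_mem (sign_mul_self ε) (Module.End.mem_eigenspace_iff.mp hx.2) (h1 hx.1)

lemma coord_weil_eSign_of_not_mem (ε : ℤˣ) {v : V} {g : U h} (hg : g ∉ B h v) :
    coord lam h v (weil lam h g (eSign lam h ε v)) = 0 := by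
  rw [mem_B_iff, not_or] at hg
  exact coord_weil_eSign_of_not_mem_B ε hg.1 hg.2

lemma weil_eSign_of_iota_mul_mem (ε : ℤˣ) {v : V} {g : U h} (hg : iota h * g ∈ C h v) :
    weil lam h g (eSign lam h ε v) =
      (((ε : ℤ) : ℂ) * beta lam h v ⟨iota h * g, hg⟩) • eSign lam h ε v := by
  have h1 : weil lam h g (eSign lam h ε v) =
      weil lam h (iota h) (weil lam h (iota h * g) (eSign lam h ε v)) := by
    rw [← Module.End.mul_apply, ← map_mul, ← mul_assoc, iota_mul_iota, one_mul]
  rw [h1, weil_eSign_of_mem ε ⟨iota h * g, hg⟩, map_smul, weil_iota_eSign, smul_smul, mul_comm]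

/-- An extension with the prescribed sign is the character of `B(v)` on the line of `e_v + ε
e_{-v}`; existence and uniqueness follow from the stability of this line. -/
lemma isBetaExtension_iff (h2 : (2 : F) ≠ 0) {ε : ℤˣ} {v : V} (hv : Primitive F v)
    (β : B h v →* ℂ) : IsBetaExtension lam h v ε β ↔
      ∀ k : B h v, weil lam h k (eSign lam h ε v) = β k • eSign lam h ε v := by
  constructor
  · intro hβ k
    rcases (mem_B_iff v).mp k.2 with hk | hk
    · rw [show β k = beta lam h v ⟨k, hk⟩ from hβ.1 ⟨k, hk⟩]
      exact weil_eSign_of_mem ε ⟨(k : U h), hk⟩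
    · have h1 : ⟨iota h, iota_mem_B h v⟩ *
          ⟨iota h * k, (le_sup_left : C h v ≤ B h v) hk⟩ = k := by
        apply Subtype.ext
        rw [Subgroup.coe_mul, ← mul_assoc, iota_mul_iota, one_mul]
      have h3 := congrArg β h1
      rw [map_mul, hβ.2, hβ.1 ⟨iota h * k, hk⟩] at h3
      rw [← h3]
      exact weil_eSign_of_iota_mul_mem ε hk
  · intro hβ
    have hinj := smul_left_injective ℂ (eSign_ne_zero (lam := lam) (h := h) h2 ε hv)
    exact ⟨fun g => hinj ((hβ _).symm.trans (weil_eSign_of_mem ε g)),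
      hinj ((hβ _).symm.trans (weil_iota_eSign ε v))⟩

/-- The character of `Top^±(s)` is induced from `β_s^±`. -/
theorem character_topSignAt [Finite V] (h2 : (2 : F) ≠ 0) (ε : ℤˣ) {v : V} (hv : Primitive F v)
    {β : B h v →* ℂ} (hβ : IsBetaExtension lam h v ε β) :
    (topSignAt lam h ε v).toRepresentation.character =
      (Representation.ind (B h v).subtype (linRep β)).character := by
  obtain ⟨φ⟩ := nonempty_equiv_ind β (weil lam h) (eSign lam h ε v) (coord lam h v)
    (coord_eSign_self h2 ε hv) (fun g hg => coord_weil_eSign_of_not_mem ε hg)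
    ((isBetaExtension_iff h2 hv β).mp hβ)
  exact (Representation.char_iso φ).symm

/-- Each `β_v` has a unique extension `β_v^±` to `B(v)`. -/
theorem existsUnique_isBetaExtension (h2 : (2 : F) ≠ 0) (ε : ℤˣ) {v : V} (hv : Primitive F v) :
    ∃! β : B h v →* ℂ, IsBetaExtension lam h v ε β := by
  have hf0 := eSign_ne_zero (lam := lam) (h := h) h2 ε hv
  obtain ⟨β, hβ⟩ := exists_character_of_stable_line (weil lam h) (B h v) hf0 fun k hk => by
    rcases (mem_B_iff v).mp hk with hk | hk
    · exact ⟨_, weil_eSign_of_mem ε ⟨k, hk⟩⟩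
    · exact ⟨_, weil_eSign_of_iota_mul_mem ε hk⟩
  refine ⟨β, (isBetaExtension_iff h2 hv β).mpr hβ, fun β' hβ' => MonoidHom.ext fun k => ?_⟩
  exact smul_left_injective ℂ hf0
    (((isBetaExtension_iff h2 hv β').mp hβ' k).symm.trans (hβ k))

/-- Two maps with the same fibres on `P` are both injective on a section `T` of the first, with full
image. -/
lemma ncard_image_eq_ncard_image {α β γ : Type*} {P : Set α} {f : α → β} {k : α → γ}
    (hfk : ∀ v ∈ P, ∀ w ∈ P, f v = f w ↔ k v = k w) : (f '' P).ncard = (k '' P).ncard := by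
  obtain ⟨T, hT, hbij⟩ := (Set.surjOn_image f P).exists_bijOn_subset
  have hk : Set.InjOn k T := fun v hv w hw hvw =>
    hbij.injOn hv hw ((hfk v (hT hv) w (hT hw)).mpr hvw)
  rw [← hbij.image_eq, hbij.injOn.ncard_image, ← hk.ncard_image]
  congr 1
  refine subset_antisymm (Set.image_mono hT) ?_
  rintro _ ⟨v, hv, rfl⟩
  obtain ⟨w, hw, hwv⟩ := hbij.surjOn (Set.mem_image_of_mem f hv)
  exact ⟨w, hw, (hfk w (hT hw) v hv).mp hwv⟩

lemma setOf_topSignAt_eq_image (S : Set V) (ε : ℤˣ) :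
    {P | ∃ s ∈ S, P = topSignAt lam h ε s} = topSignAt lam h ε '' S := by
  ext P
  exact exists_congr fun s => and_congr_right fun _ => eq_comm

lemma topSignAt_eq_iff (h2 : (2 : F) ≠ 0) {ε ε' : ℤˣ} {v w : V} (hv : Primitive F v)
    (hvw : topSignAt lam h ε v = topSignAt lam h ε' w) : ε = ε' ∧ Rel h w v := by
  have h1 := eSign_mem_topSignAt (lam := lam) (h := h) ε v
  rw [hvw] at h1
  exact eq_and_rel_of_eSign_mem h2 hv h1

variable [Module.Free (DualNumber F) V]

/-- The orbits of primitive vectors are parametrized by their lengths. -/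
theorem numOrbits_eq (hh : h.Nondegenerate) (h2 : (2 : F) ≠ 0) :
    numOrbits h = ((fun v => residue h v v) '' {v | Primitive F v}).ncard := by
  rw [← ncard_image_eq_ncard_image (f := fun v => Set.range fun g : U h => g.1 v)]
  · rw [numOrbits]
    congr 1
    ext O
    simp only [Set.mem_ofPred_eq, Set.mem_image]
    exact exists_congr fun v => and_congr_right fun _ => eq_comm
  · intro v hv w hw
    constructor
    · intro hvw
      have h1 : w ∈ Set.range fun g : U h => g.1 v := by
        change (Set.range fun g : U h => g.1 v) = Set.range fun g : U h => g.1 w at hvw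
        rw [hvw]
        exact ⟨1, rfl⟩
      obtain ⟨g, hg⟩ := h1
      exact Rel.residue_eq ⟨g, by simp [hg]⟩
    · intro hvw
      obtain ⟨g, rfl⟩ := exists_apply_eq hh h2 hv hw hvw
      refine subset_antisymm ?_ ?_
      · rintro _ ⟨k, rfl⟩
        exact ⟨k * g⁻¹, by simp [← LinearEquiv.mul_apply]⟩
      · rintro _ ⟨k, rfl⟩
        exact ⟨k * g, by simp⟩

lemma ncard_of_isRepresentativeSet (hh : h.Nondegenerate) (h2 : (2 : F) ≠ 0) {S : Set V}
    (hS : IsRepresentativeSet h S) : S.ncard = numOrbits h := by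
  have hinj : Set.InjOn (fun v => residue h v v) S := fun s hs t ht hst =>
    hS.eq_of_rel hs ht ((rel_iff hh h2 (hS.1 s hs) (hS.1 t ht)).mpr hst)
  rw [numOrbits_eq hh h2, ← hinj.ncard_image]
  congr 1
  refine subset_antisymm (Set.image_mono hS.1) ?_
  rintro _ ⟨v, hv, rfl⟩
  obtain ⟨s, ⟨hs, hvs⟩, -⟩ := hS.2 v hv
  exact ⟨s, hs, hvs.residue_eq.symm⟩

lemma ncard_setOf_topSignAt (hh : h.Nondegenerate) (h2 : (2 : F) ≠ 0) {S : Set V}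
    (hS : IsRepresentativeSet h S) (ε : ℤˣ) :
    {P | ∃ s ∈ S, P = topSignAt lam h ε s}.ncard = numOrbits h := by
  have hinj : Set.InjOn (topSignAt lam h ε) S := fun s hs t ht hst =>
    (hS.eq_of_rel ht hs (topSignAt_eq_iff h2 (hS.1 s hs) hst).2).symm
  rw [setOf_topSignAt_eq_image, hinj.ncard_image, ncard_of_isRepresentativeSet hh h2 hS]

lemma setOf_isIrreducible_eq [Finite V] (hh : h.Nondegenerate) (h2 : (2 : F) ≠ 0)
    (hlam : lam.IsPrimitive) {S : Set V} (hS : IsRepresentativeSet h S) :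
    {P : Subrepresentation (weil lam h) | P.toRepresentation.IsIrreducible} =
      insert (bot lam h) {P | ∃ ε : ℤˣ, ∃ s ∈ S, P = topSignAt lam h ε s} := by
  ext P
  rw [Set.mem_ofPred_eq, isIrreducible_iff_eq hh h2 hlam, Set.mem_insert_iff]
  refine or_congr_right ⟨?_, ?_⟩
  · rintro ⟨ε, v, hv, rfl⟩
    obtain ⟨s, ⟨hs, hvs⟩, -⟩ := hS.2 v hv
    exact ⟨ε, s, hs, topSignAt_congr ε hvs⟩
  · rintro ⟨ε, s, hs, rfl⟩
    exact ⟨ε, s, hS.1 s hs, rfl⟩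

theorem ncard_setOf_isIrreducible [Finite V] (hh : h.Nondegenerate) (h2 : (2 : F) ≠ 0)
    (hlam : lam.IsPrimitive) {S : Set V} (hS : IsRepresentativeSet h S) :
    {P : Subrepresentation (weil lam h) | P.toRepresentation.IsIrreducible}.ncard =
      2 * numOrbits h + 1 := by
  have hunion : {P | ∃ ε : ℤˣ, ∃ s ∈ S, P = topSignAt lam h ε s} =
      {P | ∃ s ∈ S, P = topSignAt lam h 1 s} ∪ {P | ∃ s ∈ S, P = topSignAt lam h (-1) s} := by
    ext P
    constructor
    · rintro ⟨ε, hP⟩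
      rcases Int.units_eq_one_or ε with rfl | rfl
      · exact Or.inl hP
      · exact Or.inr hP
    · rintro (hP | hP)
      · exact ⟨_, hP⟩
      · exact ⟨_, hP⟩
  have hfin : ∀ ε : ℤˣ, {P | ∃ s ∈ S, P = topSignAt lam h ε s}.Finite := fun ε => by
    rw [setOf_topSignAt_eq_image]
    exact (Set.toFinite S).image _
  have hdisj : Disjoint {P | ∃ s ∈ S, P = topSignAt lam h 1 s}
      {P | ∃ s ∈ S, P = topSignAt lam h (-1) s} := by
    refine Set.disjoint_left.mpr ?_
    rintro _ ⟨s, hs, rfl⟩ ⟨t, ht, hst⟩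
    exact absurd (topSignAt_eq_iff h2 (hS.1 s hs) hst).1 (by decide)
  have hbot : bot lam h ∉ {P | ∃ ε : ℤˣ, ∃ s ∈ S, P = topSignAt lam h ε s} := by
    rintro ⟨ε, s, hs, hP⟩
    exact bot_not_le_topSignAt (lam := lam) (h := h) ε (hS.1 s hs) (hP ▸ le_rfl)
  rw [setOf_isIrreducible_eq hh h2 hlam hS, Set.ncard_insert_of_notMem hbot
    (hunion ▸ (hfin _).union (hfin _)), hunion, Set.ncard_union_eq hdisj (hfin _) (hfin _),
    ncard_setOf_topSignAt hh h2 hS, ncard_setOf_topSignAt hh h2 hS, two_mul]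

end Decomposition

/-! ### The number of orbits -/

section Values

variable {F : Type*} [Field F] {V : Type*} [AddCommGroup V] [Module (DualNumber F) V]
  {h : HermitianForm F V} {ι : Type*} [Fintype ι]

/-- The vector of `V` with coordinates `x i ∈ F` in the basis `b`. -/
def ofCoords (b : Module.Basis ι (DualNumber F) V) (x : ι → F) : V :=
  b.equivFun.symm fun i => TrivSqZeroExt.inl (x i)

variable (b : Module.Basis ι (DualNumber F) V)

lemma ofCoords_eq_sum (x : ι → F) :
    ofCoords b x = ∑ i, (TrivSqZeroExt.inl (x i) : DualNumber F) • b i := by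
  rw [ofCoords, Module.Basis.equivFun_symm_apply]

lemma ofCoords_add (x z : ι → F) : ofCoords b (x + z) = ofCoords b x + ofCoords b z := by
  simp [ofCoords_eq_sum, add_smul, Finset.sum_add_distrib]

lemma ofCoords_smul (c : F) (x : ι → F) :
    ofCoords b (c • x) = (TrivSqZeroExt.inl c : DualNumber F) • ofCoords b x := by
  simp [ofCoords_eq_sum, mul_smul, Finset.smul_sum]

lemma sub_ofCoords_mem (v : V) : v - ofCoords b (fun i => (b.equivFun v i).fst) ∈ yV F V := by
  have h1 : v = ∑ i, b.equivFun v i • b i := (b.sum_equivFun v).symm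
  rw [ofCoords_eq_sum]
  nth_rewrite 1 [h1]
  rw [← Finset.sum_sub_distrib]
  refine sum_mem fun i _ => ?_
  rw [← sub_smul]
  exact smul_mem_yV (by simp) _

lemma primitive_ofCoords {x : ι → F} (hx : x ≠ 0) : Primitive F (ofCoords b x) := by
  rintro ⟨u, hu⟩
  apply hx
  ext i
  have h1 := congrArg (fun v => (b.equivFun v i).fst) hu
  simp only [LinearMap.lsmul_apply, map_smul, ofCoords, LinearEquiv.apply_symm_apply,
    Pi.smul_apply, smul_eq_mul, TrivSqZeroExt.fst_mul, DualNumber.fst_eps, zero_mul,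
    TrivSqZeroExt.fst_inl] at h1
  exact h1.symm

/-- The lengths of the primitive vectors are the values of the residual quadratic form at nonzero
coordinate vectors. -/
lemma image_residue_eq :
    (fun v => residue h v v) '' {v | Primitive F v} =
      (fun x => residue h (ofCoords b x) (ofCoords b x)) '' {x | x ≠ 0} := by
  apply subset_antisymm
  · rintro _ ⟨v, hv, rfl⟩
    have h1 := sub_ofCoords_mem b v
    refine ⟨fun i => (b.equivFun v i).fst, fun h0 => hv ?_, ?_⟩
    · rw [h0] at h1
      simpa [ofCoords_eq_sum] using h1
    · change residue h (ofCoords b _) (ofCoords b _) = residue h v v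
      rw [← residue_self_add (h := h) h1, add_sub_cancel]
  · rintro _ ⟨x, hx, rfl⟩
    exact ⟨_, primitive_ofCoords b hx, rfl⟩

variable (h) in
/-- The residual bilinear form in coordinates. -/
def residueBilin : LinearMap.BilinForm F (ι → F) :=
  LinearMap.mk₂ F (fun x z => residue h (ofCoords b x) (ofCoords b z))
    (fun x x' z => by rw [ofCoords_add, residue_add_left])
    (fun c x z => by rw [ofCoords_smul, residue_smul_left, TrivSqZeroExt.fst_inl, smul_eq_mul])
    (fun x z z' => by rw [ofCoords_add, residue_add_right])
    (fun c x z => by rw [ofCoords_smul, residue_smul_right, TrivSqZeroExt.fst_inl, smul_eq_mul])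

lemma residueBilin_apply (x z : ι → F) :
    residueBilin h b x z = residue h (ofCoords b x) (ofCoords b z) := rfl

/-- Nondegeneracy descends modulo `y`, since a vector differs from its constant-coordinate part by
an element of `yV`. -/
lemma residueBilin_separatingLeft [Module.Free (DualNumber F) V] (hh : h.Nondegenerate) :
    (residueBilin h b).SeparatingLeft := by
  intro x hx
  by_contra h0
  obtain ⟨u, hu⟩ := exists_residue_ne_zero hh (primitive_ofCoords b h0)
  apply hu
  have h1 := hx fun i => (b.equivFun u i).fst
  rw [residueBilin_apply, residue_comm] at h1
  have h3 := residue_of_mem_right (h := h) (ofCoords b x) (sub_ofCoords_mem b u)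
  rw [residue_sub_right, residue_comm _ (ofCoords b fun i => (b.equivFun u i).fst), h1,
    sub_zero] at h3
  rw [residue_comm, h3]

lemma residue_ofCoords_fin_two (b : Module.Basis (Fin 2) (DualNumber F) V) {r : Fin 2 → F}
    (hb : ∀ i j, h.form (b i) (b j) = if i = j then TrivSqZeroExt.inl (r i) else 0)
    (x : Fin 2 → F) :
    residue h (ofCoords b x) (ofCoords b x) = r 0 * x 0 ^ 2 + r 1 * x 1 ^ 2 := by
  have h1 : ∀ i j, residue h (b i) (b j) = if i = j then r i else 0 := fun i j => by
    rw [residue, hb]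
    split_ifs <;> simp
  simp only [ofCoords_eq_sum, Fin.sum_univ_two, residue_add_left, residue_add_right,
    residue_smul_left, residue_smul_right, TrivSqZeroExt.fst_inl, h1]
  simp
  ring

/-- By pigeonhole, the values of `a x²` and of `t - c z²` are too many to be disjoint when `q` is
odd. -/
lemma exists_mul_sq_add_mul_sq [Fintype F] (hF : ringChar F ≠ 2) {a c : F} (ha : a ≠ 0)
    (hc : c ≠ 0) (t : F) : ∃ x z : F, a * x ^ 2 + c * z ^ 2 = t := by
  obtain ⟨x, z, hxz⟩ := FiniteField.exists_root_sum_quadratic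
    (f := Polynomial.C a * Polynomial.X ^ 2 + Polynomial.C 0 * Polynomial.X + Polynomial.C 0)
    (g := Polynomial.C c * Polynomial.X ^ 2 + Polynomial.C 0 * Polynomial.X + Polynomial.C (-t))
    (Polynomial.degree_quadratic ha) (Polynomial.degree_quadratic hc)
    (FiniteField.odd_card_of_char_ne_two hF)
  refine ⟨x, z, ?_⟩
  simp only [Polynomial.eval_add, Polynomial.eval_mul, Polynomial.eval_C, Polynomial.eval_pow,
    Polynomial.eval_X] at hxz
  linear_combination hxz

lemma ncard_mul_sq [Fintype F] (hF : ringChar F ≠ 2) {c : F} (hc : c ≠ 0) :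
    ((fun x : F => c * x ^ 2) '' {x | x ≠ 0}).ncard = (Fintype.card F - 1) / 2 := by
  have h1 : (fun x : F => c * x ^ 2) '' {x | x ≠ 0} =
      (fun u : Fˣ => c * (u : F)) '' ((powMonoidHom 2 : Fˣ →* Fˣ).range : Set Fˣ) := by
    ext t
    constructor
    · rintro ⟨x, hx, rfl⟩
      exact ⟨Units.mk0 x hx ^ 2, ⟨Units.mk0 x hx, rfl⟩, by simp⟩
    · rintro ⟨_, ⟨u, rfl⟩, rfl⟩
      exact ⟨u, u.ne_zero, by simp⟩
  have hinj : Function.Injective fun u : Fˣ => c * (u : F) :=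
    fun u w huw => Units.ext (mul_left_cancel₀ hc huw)
  have hq : Nat.card Fˣ = Fintype.card F - 1 := by
    rw [Nat.card_units, Nat.card_eq_fintype_card]
  have hodd := FiniteField.odd_card_of_char_ne_two hF
  -- As `q - 1` is even, squaring on the cyclic group `Fˣ` has image of index `2`.
  have hgcd : (Fintype.card F - 1).gcd 2 = 2 :=
    Nat.gcd_eq_right_iff_dvd.mpr (Nat.dvd_of_mod_eq_zero (by omega))
  rw [h1, Set.ncard_image_of_injective _ hinj]
  have h3 := IsCyclic.card_powMonoidHom_range (G := Fˣ) 2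
  rw [hq, hgcd] at h3
  exact h3

variable [Module.Free (DualNumber F) V] [Fintype F]

lemma numOrbits_eq_card_of_surjective (hh : h.Nondegenerate) (hF : ringChar F ≠ 2)
    (hsurj : ∀ t : F, ∃ x : ι → F, x ≠ 0 ∧ residueBilin h b x x = t) :
    numOrbits h = Fintype.card F := by
  have h1 : (fun x => residue h (ofCoords b x) (ofCoords b x)) '' {x | x ≠ 0} = Set.univ :=
    Set.eq_univ_of_forall fun t => hsurj t
  rw [numOrbits_eq hh (Ring.two_ne_zero hF), image_residue_eq b, h1, Set.ncard_univ,
    Nat.card_eq_fintype_card]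

theorem numOrbits_of_two_lt {m : ℕ} (b : Module.Basis (Fin m) (DualNumber F) V)
    (hh : h.Nondegenerate) (hF : ringChar F ≠ 2) (hm : 2 < m) : numOrbits h = Fintype.card F := by
  have h2 : (2 : F) ≠ 0 := Ring.two_ne_zero hF
  have : Invertible (2 : F) := invertibleOfNonzero h2
  have hsymm : LinearMap.IsSymm (residueBilin h b) := ⟨fun x z => residue_comm _ _⟩
  obtain ⟨w, hw⟩ := LinearMap.BilinForm.exists_orthogonal_basis (B := residueBilin h b) hsymm
  have hne := hw.not_isOrtho_basis_self_of_separatingLeft (residueBilin_separatingLeft b hh)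
  have hm' : 2 < Module.finrank F (Fin m → F) := by simpa using hm
  let i0 : Fin (Module.finrank F (Fin m → F)) := ⟨0, by omega⟩
  let i1 : Fin (Module.finrank F (Fin m → F)) := ⟨1, by omega⟩
  let i2 : Fin (Module.finrank F (Fin m → F)) := ⟨2, hm'⟩
  have h01 : i0 ≠ i1 := by simp [i0, i1]
  have h02 : i0 ≠ i2 := by simp [i0, i2]
  have h12 : i1 ≠ i2 := by simp [i1, i2]
  have horth : ∀ i j, i ≠ j → residueBilin h b (w i) (w j) = 0 := fun i j hij => hw hij
  refine numOrbits_eq_card_of_surjective b hh hF fun t => ?_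
  obtain ⟨x, z, hxz⟩ := exists_mul_sq_add_mul_sq hF (hne i0) (hne i1)
    (t - residueBilin h b (w i2) (w i2))
  -- The coefficient `1` of the third orthogonal vector keeps the sum nonzero, even for `t = 0`; the
  -- first two supply the remaining value.
  refine ⟨x • w i0 + z • w i1 + w i2, fun hc => ?_, ?_⟩
  · have h3 := congrArg (fun v => w.repr v i2) hc
    simp [h02, h12] at h3
  · simp only [map_add, map_smul, LinearMap.add_apply, LinearMap.smul_apply, smul_eq_mul,
      horth _ _ h01, horth _ _ h02, horth _ _ h12, horth _ _ h01.symm, horth _ _ h02.symm,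
      horth _ _ h12.symm]
    linear_combination hxz

theorem numOrbits_of_hyperbolic (hh : h.Nondegenerate) (hF : ringChar F ≠ 2)
    (hb : h.IsOfType ![1, -1]) : numOrbits h = Fintype.card F := by
  obtain ⟨b, hb⟩ := hb
  have h2 : (2 : F) ≠ 0 := Ring.two_ne_zero hF
  refine numOrbits_eq_card_of_surjective b hh hF fun t => ?_
  -- Factor `t` as `t · 1` in a difference of squares; the coordinates differ by `1`, so they are
  -- not both zero.
  refine ⟨![(t + 1) / 2, (t - 1) / 2], fun hc => ?_, ?_⟩
  · have h0 := congrFun hc 0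
    have h1 := congrFun hc 1
    simp only [Matrix.cons_val_zero, Matrix.cons_val_one, Pi.zero_apply, div_eq_zero_iff, h2,
      or_false] at h0 h1
    exact h2 (by linear_combination h0 - h1)
  · rw [residueBilin_apply, residue_ofCoords_fin_two b hb]
    simp only [Matrix.cons_val_zero, Matrix.cons_val_one]
    field_simp
    ring

theorem numOrbits_of_anisotropic (hh : h.Nondegenerate) (hF : ringChar F ≠ 2) {δ : F}
    (hδ : ¬ IsSquare δ) (hb : h.IsOfType ![1, -δ]) : numOrbits h = Fintype.card F - 1 := by
  obtain ⟨b, hb⟩ := hb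
  have hδ0 : δ ≠ 0 := fun hc => hδ (hc ▸ IsSquare.zero)
  have hval : ∀ x : Fin 2 → F, residue h (ofCoords b x) (ofCoords b x) =
      1 * x 0 ^ 2 + -δ * x 1 ^ 2 := residue_ofCoords_fin_two b hb
  have h1 : (fun x => residue h (ofCoords b x) (ofCoords b x)) '' {x | x ≠ 0} = {0}ᶜ := by
    ext t
    rw [Set.mem_compl_iff, Set.mem_singleton_iff]
    constructor
    · rintro ⟨x, hx, rfl⟩ h0
      change residue h (ofCoords b x) (ofCoords b x) = 0 at h0
      rw [hval] at h0
      by_cases hx1 : x 1 = 0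
      · have hx0 : x 0 = 0 := by
          rw [hx1] at h0
          exact pow_eq_zero_iff two_ne_zero |>.mp (by linear_combination h0)
        apply hx
        ext i
        fin_cases i
        · exact hx0
        · exact hx1
      -- A nontrivial zero would exhibit `δ` as a square, so the length `0` is not attained.
      · refine hδ ⟨x 0 / x 1, ?_⟩
        field_simp
        linear_combination -h0
    · intro ht
      obtain ⟨x, z, hxz⟩ := exists_mul_sq_add_mul_sq hF one_ne_zero (neg_ne_zero.mpr hδ0) t
      refine ⟨![x, z], fun hc => ht ?_, ?_⟩
      · have h0 := congrFun hc 0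
        have h1 := congrFun hc 1
        simp only [Matrix.cons_val_zero, Matrix.cons_val_one, Pi.zero_apply] at h0 h1
        rw [← hxz, h0, h1]
        ring
      · change residue h (ofCoords b ![x, z]) (ofCoords b ![x, z]) = t
        rw [hval, ← hxz]
        simp
  rw [numOrbits_eq hh (Ring.two_ne_zero hF), image_residue_eq b, h1, Set.ncard_compl,
    Set.ncard_singleton, Nat.card_eq_fintype_card]

/-- The residual form is `c x²` with `c ≠ 0` by nondegeneracy, so the lengths form one coset of the
nonzero squares. -/
theorem numOrbits_of_rank_one (b : Module.Basis (Fin 1) (DualNumber F) V)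
    (hh : h.Nondegenerate) (hF : ringChar F ≠ 2) :
    numOrbits h = (Fintype.card F - 1) / 2 := by
  have hval : ∀ x : Fin 1 → F, residue h (ofCoords b x) (ofCoords b x) =
      residue h (b 0) (b 0) * x 0 ^ 2 := fun x => by
    simp only [ofCoords_eq_sum, Fin.sum_univ_one, residue_smul_left, residue_smul_right,
      TrivSqZeroExt.fst_inl]
    ring
  have hb0 : residue h (b 0) (b 0) ≠ 0 := by
    intro h0
    have h1 := residueBilin_separatingLeft b hh (fun _ => 1) fun z => by
      rw [residueBilin_apply]
      simp only [ofCoords_eq_sum, Fin.sum_univ_one, residue_smul_left, residue_smul_right, h0,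
        mul_zero]
    exact one_ne_zero (congrFun h1 0)
  rw [numOrbits_eq hh (Ring.two_ne_zero hF), image_residue_eq b, ← ncard_mul_sq hF hb0]
  congr 1
  ext t
  constructor
  · rintro ⟨x, hx, rfl⟩
    refine ⟨x 0, fun h0 => hx ?_, (hval x).symm⟩
    ext i
    rw [Subsingleton.elim i 0]
    exact h0
  · rintro ⟨x, hx, rfl⟩
    exact ⟨fun _ => x, fun h0 => hx (congrFun h0 0), hval _⟩

end Values

end RamifiedWeil

end

theorem mainTheorem12 {F : Type*} [Field F] [Fintype F] (hF : ringChar F ≠ 2)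
    {V : Type*} [AddCommGroup V] [Module (DualNumber F) V]
    [Module.Free (DualNumber F) V] [Module.Finite (DualNumber F) V]
    (m : ℕ) (hm : 1 ≤ m) (hV : Module.finrank (DualNumber F) V = m)
    (h : RamifiedWeil.HermitianForm F V) (hh : h.Nondegenerate)
    (lam : AddChar F ℂ) (hlam : lam.IsPrimitive)
    (S : Set V) (hS : RamifiedWeil.IsRepresentativeSet h S) :
    -- (a) the direct sum decompositions of Top⁺ and Top⁻
    (∀ ε : ℤˣ,
      iSupIndep (fun s : S => (RamifiedWeil.topSignAt lam h ε s).toSubmodule) ∧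
      ⨆ s : S, (RamifiedWeil.topSignAt lam h ε s).toSubmodule =
        (RamifiedWeil.topSign lam h ε).toSubmodule) ∧
    -- (b) irreducibility and characters of the summands
    (∀ ε : ℤˣ, ∀ s ∈ S,
      (RamifiedWeil.topSignAt lam h ε s).toRepresentation.IsIrreducible ∧
      (∃! β : RamifiedWeil.B h s →* ℂ, RamifiedWeil.IsBetaExtension lam h s ε β) ∧
      ∀ β : RamifiedWeil.B h s →* ℂ, RamifiedWeil.IsBetaExtension lam h s ε β →
        (RamifiedWeil.topSignAt lam h ε s).toRepresentation.character =
          (Representation.ind (RamifiedWeil.B h s).subtype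
            (RamifiedWeil.linRep β)).character) ∧
    -- (c) multiplicity freeness, the list of constituents and their number
    RamifiedWeil.IsMultiplicityFree (RamifiedWeil.weil lam h) ∧
    Nonempty ((RamifiedWeil.bot lam h).toRepresentation.Equiv
      (Representation.trivial ℂ (RamifiedWeil.U h) ℂ)) ∧
    {P : Subrepresentation (RamifiedWeil.weil lam h) | P.toRepresentation.IsIrreducible} =
      insert (RamifiedWeil.bot lam h)
        {P | ∃ ε : ℤˣ, ∃ s ∈ S, P = RamifiedWeil.topSignAt lam h ε s} ∧
    {P : Subrepresentation (RamifiedWeil.weil lam h) |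
      P.toRepresentation.IsIrreducible}.ncard = 2 * RamifiedWeil.numOrbits h + 1 ∧
    (∀ ε : ℤˣ, {P | ∃ s ∈ S, P = RamifiedWeil.topSignAt lam h ε s}.ncard =
      RamifiedWeil.numOrbits h) ∧
    (2 < m → RamifiedWeil.numOrbits h = Fintype.card F) ∧
    (m = 2 → h.IsOfType ![1, -1] → RamifiedWeil.numOrbits h = Fintype.card F) ∧
    (∀ δ : F, ¬ IsSquare δ → m = 2 → h.IsOfType ![1, -δ] →
      RamifiedWeil.numOrbits h = Fintype.card F - 1) ∧
    (m = 1 → RamifiedWeil.numOrbits h = (Fintype.card F - 1) / 2) := by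
  have h2 : (2 : F) ≠ 0 := Ring.two_ne_zero hF
  have : Finite (DualNumber F) := inferInstanceAs (Finite (F × F))
  have : Finite V := Module.finite_of_finite (DualNumber F)
  let b := Module.finBasisOfFinrankEq (DualNumber F) V hV
  refine ⟨fun ε => ⟨RamifiedWeil.iSupIndep_topSignAt hS ε, RamifiedWeil.iSup_topSignAt hS ε⟩,
    fun ε s hs => ⟨RamifiedWeil.isIrreducible_topSignAt hh h2 hlam ε (hS.1 s hs),
      RamifiedWeil.existsUnique_isBetaExtension h2 ε (hS.1 s hs),
      fun β hβ => RamifiedWeil.character_topSignAt h2 ε (hS.1 s hs) hβ⟩,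
    RamifiedWeil.isMultiplicityFree_weil hh h2 hlam, RamifiedWeil.nonempty_bot_equiv_trivial,
    RamifiedWeil.setOf_isIrreducible_eq hh h2 hlam hS,
    RamifiedWeil.ncard_setOf_isIrreducible hh h2 hlam hS,
    RamifiedWeil.ncard_setOf_topSignAt hh h2 hS,
    RamifiedWeil.numOrbits_of_two_lt b hh hF,
    fun _ hb => RamifiedWeil.numOrbits_of_hyperbolic hh hF hb,
    fun δ hδ _ hb => RamifiedWeil.numOrbits_of_anisotropic hh hF hδ hb,
    fun hm1 => ?_⟩
  subst hm1
  exact RamifiedWeil.numOrbits_of_rank_one b hh hF
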